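/- Let $K$ be a field, $n\ge 1$, $R=K[X_1,\dots,X_n]$, $\mathfrak m=(X_1,\dots,X_n)$. Consider $R$ with the standard grading ($\mathbb Z$-grading, $\deg X_i=1$) and with the multigrading ($\mathbb Z^n$-grading, $\deg X_i=e_i$). Let $M(n,k)$ be the $k$-th syzygy module of $K=R/\mathfrak m$: for $k\ge 1$ it is the image $\partial(\bigwedge^k R^n)\subseteq\bigwedge^{k-1}R^n$ in the Koszul complex of $X_1,\dots,X_n$, and $M(n,0)=K$. It is graded by giving $e_{i_1}\wedge\dots\wedge e_{i_k}$ the degree of $X_{i_1}\cdots X_{i_k}$. For either grading, a graded retract of $R$ is a $K$-subalgebra $S\subseteq R$ for which there is a graded $K$-algebra epimorphism $\pi:R\to S$ with $\pi|_S=\mathrm{id}$. A Hilbert decomposition of a finitely generated graded $R$-module $M$ is a finite family $(S_i,s_i)_{i\in I}$ of graded retracts $S_i$ and degrees $s_i$ (in $\mathbb Z$, respectively $\mathbb Z^n$) such that $M\cong\bigoplus_{i\in I}S_i(-s_i)$ as graded $K$-vector spaces; its depth is the depth of the $R$-module $\bigoplus_{i\in I} S_i$, where $R$ acts on $S_i$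 through an epimorphism $\pi_i:R\to S_i$ as above. The Hilbert depth of $M$ is the maximal depth of a Hilbert decomposition of $M$; it is denoted $\operatorname{Hdepth}_1 M$ for the standard grading and $\operatorname{Hdepth}_n M$ for the multigrading. Theorem. Suppose $n>k\ge\lfloor n/2\rfloor$. Then $$\operatorname{Hdepth}_1 M(n,k)=\operatorname{Hdepth}_n M(n,k)=n-1 .$$ -/

import Mathlib

open MvPolynomial

noncomputable section

namespace HilbertDepth

/-! ### Gradings of the polynomial ring

Both gradings of `K[X_i : i ∈ σ]` are given by the degrees `w i` of the indeterminates. The component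
of degree `g` is `weightedHomogeneousSubmodule K w g`. -/

/-- The multigrading: `X_i` has degree `e_i ∈ ℤⁿ`. -/
def multiWeight (n : ℕ) : Fin n → (Fin n → ℤ) := fun i => Pi.single i 1

/-- The standard grading: every `X_i` has degree `1 ∈ ℤ`. -/
def standardWeight (n : ℕ) : Fin n → ℤ := fun _ => 1

/-- The ideal `𝔪` generated by the indeterminates. -/
def maxIdeal (K : Type*) [Field K] (σ : Type*) : Ideal (MvPolynomial σ K) :=
  Ideal.span (Set.range X)

/-! ### Depth -/

/-- The depth of a graded module over `R = K[X_i : i ∈ σ]`: the supremum of the lengths of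
`M`-sequences in `𝔪`. If `𝔪 M ≠ M` (in particular for a nonzero finitely generated graded module `M`),
then a weakly regular sequence in `𝔪` is automatically regular; the zero module has depth `∞`. -/
def depth (K : Type*) [Field K] (σ : Type*) (M : Type*) [AddCommGroup M]
    [Module (MvPolynomial σ K) M] : ℕ∞ :=
  sSup {d | ∃ rs : List (MvPolynomial σ K), (∀ r ∈ rs, r ∈ maxIdeal K σ) ∧
    RingTheory.Sequence.IsWeaklyRegular M rs ∧ (rs.length : ℕ∞) = d}

/-! ### Graded retracts and Hilbert decompositions -/

/-- A graded retract of `R = K[X_i : i ∈ σ]`: a subalgebra `S` together with a graded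
`K`-algebra homomorphism `π : R → S` that restricts to the identity on `S`. -/
structure GradedRetract (K : Type*) [Field K] {σ ι : Type*} [AddCommGroup ι] (w : σ → ι) where
  S : Subalgebra K (MvPolynomial σ K)
  π : MvPolynomial σ K →ₐ[K] S
  π_apply : ∀ s : S, π (s : MvPolynomial σ K) = s
  π_graded : ∀ (g : ι) (f : MvPolynomial σ K), f ∈ weightedHomogeneousSubmodule K w g →
    (π f : MvPolynomial σ K) ∈ weightedHomogeneousSubmodule K w g

namespace GradedRetract

variable {K : Type*} [Field K] {σ ι : Type*} [AddCommGroup ι] {w : σ → ι}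

/-- The retract `S`, viewed as an `R`-module through `π : R → S`. -/
def Carrier (ρ : GradedRetract K w) : Type _ := ρ.S

instance (ρ : GradedRetract K w) : AddCommGroup ρ.Carrier :=
  inferInstanceAs (AddCommGroup ρ.S)

instance (ρ : GradedRetract K w) : Module (MvPolynomial σ K) ρ.Carrier :=
  Module.compHom ρ.S ρ.π.toRingHom

/-- The component of degree `g` of the shifted retract `S(-s)`, namely `S_{g - s}`. -/
def shiftedPiece (ρ : GradedRetract K w) (s g : ι) : Submodule K (MvPolynomial σ K) :=
  Subalgebra.toSubmodule ρ.S ⊓ weightedHomogeneousSubmodule K w (g - s)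

end GradedRetract

/-- A Hilbert decomposition of a graded `K`-vector space `M` with components `𝓜 g`: a finite family
`(S_i, s_i)` of graded retracts and shifts such that `M ≅ ⨁ S_i(-s_i)` as graded vector spaces. -/
structure HilbertDecomposition {K : Type*} [Field K] {σ ι : Type*} [AddCommGroup ι] (w : σ → ι)
    {M : Type*} [AddCommGroup M] [Module K M] (𝓜 : ι → Submodule K M) where
  I : Type
  [fintype : Fintype I]
  retract : I → GradedRetract K w
  shift : I → ι
  iso : ∀ g : ι, Nonempty (𝓜 g ≃ₗ[K] ∀ i : I, (retract i).shiftedPiece (shift i) g)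

/-- The depth of a Hilbert decomposition: the depth of the `R`-module `⨁ S_i`, a finite direct
sum. -/
def HilbertDecomposition.depth {K : Type*} [Field K] {σ ι : Type*} [AddCommGroup ι] {w : σ → ι}
    {M : Type*} [AddCommGroup M] [Module K M] {𝓜 : ι → Submodule K M}
    (D : HilbertDecomposition w 𝓜) : ℕ∞ :=
  HilbertDepth.depth K σ (∀ i : D.I, (D.retract i).Carrier)

/-- `d` is the Hilbert depth of `M`: the maximal depth of a Hilbert decomposition of `M`. -/
def IsHilbertDepth {K : Type*} [Field K] {σ ι : Type*} [AddCommGroup ι] (w : σ → ι)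
    {M : Type*} [AddCommGroup M] [Module K M] (𝓜 : ι → Submodule K M) (d : ℕ∞) : Prop :=
  IsGreatest {e : ℕ∞ | ∃ D : HilbertDecomposition w 𝓜, D.depth = e} d

/-! ### The Koszul complex and the syzygy modules of the residue field -/

section Koszul

variable (K : Type*) [Field K] (n : ℕ)

/-- The free module `⋀ Rⁿ = ⨁ₖ ⋀ᵏ Rⁿ`, in coordinates with respect to the basis
`e_F = e_{i₁} ∧ ⋯ ∧ e_{iₖ}`, `F = {i₁ < ⋯ < iₖ} ⊆ {1, …, n}`. -/
abbrev Ext : Type _ := Finset (Fin n) → MvPolynomial (Fin n) K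

/-- The submodule `⋀ᵏ Rⁿ`, generated by the `e_F` with `|F| = k`. -/
def extPower (k : ℕ) : Submodule (MvPolynomial (Fin n) K) (Ext K n) :=
  Submodule.span _ {x | ∃ F : Finset (Fin n), F.card = k ∧ x = Pi.single F 1}

/-- The Koszul differential
`∂(e_{i₁} ∧ ⋯ ∧ e_{iₖ}) = ∑ⱼ (-1)^{j-1} X_{iⱼ} e_{i₁} ∧ ⋯ ∧ ê_{iⱼ} ∧ ⋯ ∧ e_{iₖ}`. -/
def koszulD : Ext K n →ₗ[MvPolynomial (Fin n) K] Ext K n :=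
  (Pi.basisFun (MvPolynomial (Fin n) K) (Finset (Fin n))).constr (MvPolynomial (Fin n) K)
    fun F => ∑ i ∈ F, Pi.single (F.erase i) ((-1) ^ (F.filter (· < i)).card * X i)

/-- The residue field `K = R/𝔪`, as an `R`-module. -/
abbrev ResidueField : Type _ := MvPolynomial (Fin n) K ⧸ maxIdeal K (Fin n)

/-- The augmentation `⋀⁰ Rⁿ = R → R/𝔪 = K` (zero on the other exterior powers). -/
def augmentation : Ext K n →ₗ[MvPolynomial (Fin n) K] ResidueField K n :=
  (Submodule.mkQ (maxIdeal K (Fin n))).comp (LinearMap.proj ∅)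

/-- The differential of the augmented Koszul complex `⋯ → ⋀² Rⁿ → Rⁿ → R → K → 0`, with all terms
after the first arrow collected into one direct sum. -/
def augmentedD : Ext K n →ₗ[MvPolynomial (Fin n) K] Ext K n × ResidueField K n :=
  (koszulD K n).prod (augmentation K n)

/-- The `k`-th syzygy module `M(n,k)` of `K`: the image of `⋀ᵏ Rⁿ` under the differential of the
augmented Koszul complex. So it is `∂(⋀ᵏ Rⁿ) ⊆ ⋀ᵏ⁻¹ Rⁿ` for `k ≥ 1`, and `K` itself for `k = 0`. -/
def syzygy (k : ℕ) : Submodule (MvPolynomial (Fin n) K) (Ext K n × ResidueField K n) :=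
  (extPower K n k).map (augmentedD K n)

variable {n} {ι : Type*} [AddCommGroup ι] (w : Fin n → ι)

/-- The component of degree `g` of `⋀ Rⁿ`, where `e_F` has the degree of `∏_{i ∈ F} X_i`. -/
def extPiece (g : ι) : Submodule K (Ext K n) :=
  Submodule.pi Set.univ fun F => weightedHomogeneousSubmodule K w (g - ∑ i ∈ F, w i)

/-- The component of degree `g` of `R/𝔪`, the image of `R_g`. -/
def residuePiece (g : ι) : Submodule K (ResidueField K n) :=
  (weightedHomogeneousSubmodule K w g).map
    (Ideal.Quotient.mkₐ K (maxIdeal K (Fin n))).toLinearMap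

/-- The component of degree `g` of the syzygy module `M(n,k)`. -/
def syzygyPiece (k : ℕ) (g : ι) : Submodule K (syzygy K n k) :=
  ((extPiece K w g).prod (residuePiece K w g)).comap
    ((syzygy K n k).subtype.restrictScalars K)

end Koszul

end HilbertDepth

end

open MvPolynomial

noncomputable section

namespace HilbertDepth

/-! ### Weakly regular sequences -/

section Regular

open RingTheory.Sequence

/-! Everything is done for an arbitrary grading group with a homomorphism `deg` to `ℤ` sending every
`w i` to 1; both gradings are instances. Write `H(g)` for the dimension of `R_g`, and `w(F)` for the
degree of `e_F`.

The Koszul complex is exact, so in degree `g` the module `M(n,k)` has dimension `∑ (-1)^(|F|-k) H(g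
- w(F))`, summed over `|F| ≥ k` (`finrank_syzygyPiece`).

Upper bound. A retract other than `R` is a proper quotient of the domain `R`, so its dimension is at
most `n - 1`, and so is the length of any weakly regular sequence in `𝔪`. A decomposition of depth
at least `n` would therefore use only copies of `R`, and the Hilbert function would be a sum of
shifts of `H` with nonnegative coefficients. Shifts of `H` are linearly independent
(`sum_coeff_eq_zero`), while the sets with `|F| = k + 1`, which exist because `k < n`, contribute
negative coefficients.

Lower bound. For `k ≥ ⌊n/2⌋` the local LYM inequality and Hall's theorem match each set `G` with
`|G| > k` injectively to some `G \ {m(G)}` (`exists_matching`). In the alternating sum each negative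
term `G` is cancelled against the positive term `F = G \ {i}`, `i = m(G)`: the difference `H(g -
w(F)) - H(g - w(G))` is the Hilbert function of `R/(X_i)` shifted by `w(F)`. The unmatched positive
terms remain as copies of `R`. So only `R` and the `R/(X_i)` occur, and on all of them the `n - 1`
differences of consecutive indeterminates form a weakly regular sequence
(`isWeaklyRegular_coordinateRetract`). -/

theorem ideal_smul_top_pi {R I : Type*} [CommRing R] [Fintype I] {M : I → Type*}
    [∀ i, AddCommGroup (M i)] [∀ i, Module R (M i)] (J : Ideal R) :
    (J • ⊤ : Submodule R (∀ i, M i)) = Submodule.pi Set.univ fun i => (J • ⊤ : Submodule R (M i)) := by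
  classical
  apply le_antisymm
  · refine Submodule.smul_le.2 fun r hr x _ i _ => ?_
    exact Submodule.smul_mem_smul hr trivial
  · intro x hx
    have h : x = ∑ i, LinearMap.single R M i (x i) := by
      ext j
      simp [Finset.sum_apply]
    rw [h]
    refine Submodule.sum_mem _ fun i _ => ?_
    have h1 : (J • ⊤ : Submodule R (M i)).map (LinearMap.single R M i) ≤ J • ⊤ := by
      rw [Submodule.map_smul'']
      exact Submodule.smul_mono le_rfl le_top
    exact h1 (Submodule.mem_map_of_mem (hx i trivial))

theorem isWeaklyRegular_iff_mem {R M : Type*} [CommRing R] [AddCommGroup M] [Module R M]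
    (rs : List R) :
    IsWeaklyRegular M rs ↔ ∀ i (h : i < rs.length) (x : M),
      rs[i] • x ∈ (Ideal.ofList (rs.take i) • ⊤ : Submodule R M) →
        x ∈ (Ideal.ofList (rs.take i) • ⊤ : Submodule R M) := by
  simp only [isWeaklyRegular_iff, isSMulRegular_quotient_iff_mem_of_smul_mem]

theorem isWeaklyRegular_pi {R I : Type*} [CommRing R] [Fintype I] {M : I → Type*}
    [∀ i, AddCommGroup (M i)] [∀ i, Module R (M i)] (rs : List R) :
    IsWeaklyRegular (∀ i, M i) rs ↔ ∀ i, IsWeaklyRegular (M i) rs := by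
  classical
  simp only [isWeaklyRegular_iff_mem, ideal_smul_top_pi, Submodule.mem_pi, Set.mem_univ,
    true_implies, Pi.smul_apply]
  constructor
  · intro H j i h x hx
    have := H i h (Pi.single j x) (fun l => ?_) j
    · simpa using this
    · by_cases hl : l = j
      · subst hl; simpa using hx
      · simp [Pi.single_eq_of_ne hl]
  · intro H i h x hx j
    exact H j i h _ (hx j)

/-- Depth is bounded by dimension: an `M`-regular element lies in no minimal prime of the
annihilator of `M`, so each term of the sequence lowers the dimension by at least one. -/
theorem supportDim_add_length_le {R : Type*} [CommRing R] [IsNoetherianRing R] (rs : List R) :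
    ∀ {M : Type*} [AddCommGroup M] [Module R M] [Module.Finite R M], IsWeaklyRegular M rs →
      Module.supportDim R (M ⧸ (Ideal.ofList rs • ⊤ : Submodule R M)) + rs.length ≤
        Module.supportDim R M := by
  induction rs with
  | nil =>
    intro M _ _ _ _
    rw [Ideal.ofList_nil, Submodule.bot_smul]
    simpa using (Module.supportDim_eq_of_equiv (Submodule.quotEquivOfEqBot ⊥ rfl)).le
  | cons x rs ih =>
    intro M _ _ _ reg
    obtain ⟨h1, h2⟩ := (isWeaklyRegular_cons_iff M _ _).mp reg
    have h3 := Module.supportDim_quotSMulTop_succ_le_of_notMem_minimalPrimes (R := R) (M := M)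
      (x := x) fun _ => h1.notMem_of_mem_minimalPrimes
    have h4 := ih h2
    rw [Module.supportDim_eq_of_equiv (Submodule.quotOfListConsSMulTopEquivQuotSMulTopInner M x _)]
    refine le_trans ?_ h3
    push_cast [List.length_cons]
    rw [← add_assoc]
    gcongr

end Regular

/-! ### Graded retracts as `R`-modules, and the bound on their depth. -/

namespace GradedRetract

variable {K : Type*} [Field K] {n : ℕ} {ι : Type*} [AddCommGroup ι] {w : Fin n → ι}

theorem π_surjective (ρ : GradedRetract K w) : Function.Surjective ρ.π := fun s => ⟨s, ρ.π_apply s⟩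

/-- The map `π : R → S`, as a map of `R`-modules. -/
def toCarrier (ρ : GradedRetract K w) :
    MvPolynomial (Fin n) K →ₗ[MvPolynomial (Fin n) K] ρ.Carrier where
  toFun := ρ.π
  map_add' := map_add ρ.π
  map_smul' r x := map_mul ρ.π r x

/-- The inclusion `S → R`, on the `R`-module `S`. -/
def val (ρ : GradedRetract K w) : ρ.Carrier →+ MvPolynomial (Fin n) K :=
  (ρ.S.val : ρ.S →+ MvPolynomial (Fin n) K)

theorem val_smul (ρ : GradedRetract K w) (r : MvPolynomial (Fin n) K) (m : ρ.Carrier) :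
    ρ.val (r • m) = ρ.π r * ρ.val m := rfl

theorem val_toCarrier (ρ : GradedRetract K w) (r : MvPolynomial (Fin n) K) :
    ρ.val (ρ.toCarrier r) = ρ.π r := rfl

theorem val_injective (ρ : GradedRetract K w) : Function.Injective ρ.val := Subtype.val_injective

theorem toCarrier_val (ρ : GradedRetract K w) (m : ρ.Carrier) : ρ.toCarrier (ρ.val m) = m :=
  ρ.π_apply m

/-- Since `π` preserves degrees and `w i ≠ 0`, the image of `X_i` has no constant term. This is what
makes `𝔪 S ≠ S`. -/
theorem constantCoeff_π (hw : ∀ i, w i ≠ 0) (ρ : GradedRetract K w) {r : MvPolynomial (Fin n) K}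
    (hr : r ∈ maxIdeal K (Fin n)) : constantCoeff (ρ.π r : MvPolynomial (Fin n) K) = 0 := by
  have : maxIdeal K (Fin n) ≤ RingHom.ker ((constantCoeff (R := K) (σ := Fin n)).comp
      ((ρ.S.val : ρ.S →+* MvPolynomial (Fin n) K).comp (ρ.π : MvPolynomial (Fin n) K →+* ρ.S))) := by
    refine Ideal.span_le.2 ?_
    rintro _ ⟨i, rfl⟩
    have h := ρ.π_graded (w i) (X i) (isWeightedHomogeneous_X K w i)
    have h0 := IsWeightedHomogeneous.coeff_eq_zero h 0 (by simpa using (hw i).symm)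
    simpa [RingHom.mem_ker, constantCoeff_eq] using h0
  simpa [RingHom.mem_ker] using this hr

/-- A nonzero element of the kernel annihilates `S`, and `R` is a domain, so `dim S + 1 ≤ n`. The
quotient of `S` by the sequence does not contain 1 among its zeros, hence has dimension at least 0.
-/
theorem length_lt_of_isWeaklyRegular (hw : ∀ i, w i ≠ 0) (ρ : GradedRetract K w)
    (hker : RingHom.ker ρ.π ≠ ⊥) (rs : List (MvPolynomial (Fin n) K))
    (hrs : ∀ r ∈ rs, r ∈ maxIdeal K (Fin n))
    (reg : RingTheory.Sequence.IsWeaklyRegular ρ.Carrier rs) : rs.length < n := by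
  have hsurj : Function.Surjective ρ.toCarrier := ρ.π_surjective
  have _ : Module.Finite (MvPolynomial (Fin n) K) ρ.Carrier := Module.Finite.of_surjective _ hsurj
  have h1 := supportDim_add_length_le rs reg
  have hI : Ideal.ofList rs ≤ maxIdeal K (Fin n) := Ideal.span_le.2 hrs
  have hmem : ∀ x ∈ (Ideal.ofList rs • ⊤ : Submodule (MvPolynomial (Fin n) K) ρ.Carrier),
      constantCoeff (ρ.val x) = 0 := by
    intro x hx
    refine Submodule.smul_induction_on hx (fun r hr m _ => ?_) fun x y hx hy => ?_
    · rw [val_smul, map_mul, constantCoeff_π hw ρ (hI hr), zero_mul]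
    · rw [map_add, map_add, hx, hy, add_zero]
  have : Nontrivial (ρ.Carrier ⧸ (Ideal.ofList rs • ⊤ :
      Submodule (MvPolynomial (Fin n) K) ρ.Carrier)) := by
    refine Submodule.Quotient.nontrivial_iff.2 fun h => ?_
    have h1 : ρ.toCarrier 1 ∈ (Ideal.ofList rs • ⊤ :
      Submodule (MvPolynomial (Fin n) K) ρ.Carrier) := by rw [h]; trivial
    have := hmem _ h1
    simp [val_toCarrier] at this
  have h2 : (0 : WithBot ℕ∞) ≤ Module.supportDim (MvPolynomial (Fin n) K) (ρ.Carrier ⧸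
      (Ideal.ofList rs • ⊤ : Submodule (MvPolynomial (Fin n) K) ρ.Carrier)) :=
    Order.krullDim_nonneg_iff.2 Module.nonempty_support_of_nontrivial.to_subtype
  obtain ⟨f, hf, hf0⟩ := Submodule.exists_mem_ne_zero_of_ne_bot hker
  have h3 : Module.supportDim (MvPolynomial (Fin n) K) ρ.Carrier + 1 ≤ (n : WithBot ℕ∞) := by
    rw [Module.supportDim_eq_ringKrullDim_quotient_annihilator]
    have h4 := ringKrullDim_succ_le_of_surjective
      (Ideal.Quotient.mk (Module.annihilator (MvPolynomial (Fin n) K) ρ.Carrier))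
      Ideal.Quotient.mk_surjective (mem_nonZeroDivisors_of_ne_zero hf0)
      (Ideal.Quotient.eq_zero_iff_mem.2 (Module.mem_annihilator.2 fun m => by
        apply ρ.val_injective
        rw [val_smul, (RingHom.mem_ker).1 hf]
        simp))
    refine h4.trans ?_
    rw [MvPolynomial.ringKrullDim_of_isNoetherianRing]
    simp [ringKrullDim_eq_zero_of_field]
  have h5 : ((rs.length + 1 : ℕ) : WithBot ℕ∞) ≤ (n : WithBot ℕ∞) := by
    refine le_trans ?_ h3
    push_cast
    gcongr
    refine le_trans ?_ h1
    simpa using add_le_add_left h2 _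
  have : rs.length + 1 ≤ n := by exact_mod_cast h5
  omega

theorem eq_top_of_ker_eq_bot (ρ : GradedRetract K w) (h : RingHom.ker ρ.π = ⊥) : ρ.S = ⊤ := by
  refine eq_top_iff.2 fun f _ => ?_
  have hinj : Function.Injective ρ.π := (RingHom.injective_iff_ker_eq_bot _).2 h
  have : (ρ.π f : MvPolynomial (Fin n) K) = f := hinj (ρ.π_apply (ρ.π f))
  rw [← this]
  exact (ρ.π f).2

end GradedRetract

/-! ### Exactness of the Koszul complex -/

section Exactness

variable (K : Type*) [Field K] {n : ℕ}

/-- The sign of `i` relative to `F`, where `e_i ∧ e_F = ± e_{F ∪ {i}}` for `i ∉ F`. -/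
def koszulSign (i : Fin n) (F : Finset (Fin n)) : K := (-1) ^ (F.filter (· < i)).card

variable {K}

theorem koszulSign_mul_self (i : Fin n) (F : Finset (Fin n)) :
    koszulSign K i F * koszulSign K i F = 1 := by
  rw [koszulSign, ← mul_pow]; simp

theorem koszulSign_insert {i j : Fin n} {F : Finset (Fin n)} (hi : i ∉ F) :
    koszulSign K j (insert i F) = (if i < j then -1 else 1) * koszulSign K j F := by
  unfold koszulSign
  rw [Finset.filter_insert]
  split_ifs with h
  · rw [Finset.card_insert_of_notMem (by simp [hi]), pow_succ, mul_comm]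
  · rw [one_mul]

theorem koszulSign_mul_insert {i j : Fin n} {F : Finset (Fin n)} (hij : i ≠ j) (hi : i ∉ F)
    (hj : j ∉ F) : koszulSign K i F * koszulSign K j (insert i F) =
      -(koszulSign K j F * koszulSign K i (insert j F)) := by
  rw [koszulSign_insert hi, koszulSign_insert hj]
  rcases lt_or_gt_of_ne hij with h | h
  · rw [if_pos h, if_neg h.not_gt]; ring
  · rw [if_neg h.not_gt, if_pos h]; ring

theorem koszulSign_insert_mul_insert {i j : Fin n} {F : Finset (Fin n)} (hij : i ≠ j)
    (hi : i ∉ F) (hj : j ∉ F) : koszulSign K j (insert i F) * koszulSign K i (insert j F) =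
      -(koszulSign K i F * koszulSign K j F) := by
  rw [koszulSign_insert hi, koszulSign_insert hj]
  rcases lt_or_gt_of_ne hij with h | h
  · rw [if_pos h, if_neg h.not_gt]; ring
  · rw [if_neg h.not_gt, if_pos h]; ring

theorem koszulD_apply (x : Ext K n) (G : Finset (Fin n)) :
    koszulD K n x G = ∑ i ∈ Gᶜ, koszulSign K i G • (X i * x (insert i G)) := by
  classical
  have key : ∀ F : Finset (Fin n), ∀ i : Fin n, ((if i ∈ F then (Pi.single (F.erase i)
      ((-1) ^ (F.filter (· < i)).card * X i) : Ext K n) G else 0) : MvPolynomial (Fin n) K) =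
      if i ∈ Gᶜ then (if F = insert i G then koszulSign K i G • X i else 0) else 0 := by
    intro F i
    by_cases hF : i ∈ F ∧ F.erase i = G
    · obtain ⟨h1, rfl⟩ := hF
      rw [if_pos h1, Pi.single_eq_same, if_pos (by simp), if_pos (Finset.insert_erase h1).symm,
        smul_eq_C_mul, koszulSign]
      -- The sign counts only elements strictly below `i`, so it is the same for `F` and for `F \
      -- {i}`.
      have : (F.erase i).filter (· < i) = F.filter (· < i) := by
        ext j
        simp only [Finset.mem_filter, Finset.mem_erase]
        exact ⟨fun h => ⟨h.1.2, h.2⟩, fun h => ⟨⟨h.2.ne, h.1⟩, h.2⟩⟩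
      rw [this]
      simp
    · have hl : (if i ∈ F then (Pi.single (F.erase i)
          ((-1) ^ (F.filter (· < i)).card * X i) : Ext K n) G else 0) = 0 := by
        split_ifs with h
        · exact Pi.single_eq_of_ne (fun h2 => hF ⟨h, h2.symm⟩) _
        · rfl
      rw [hl]
      split_ifs with h1 h2
      · exfalso
        subst h2
        exact hF ⟨Finset.mem_insert_self _ _, Finset.erase_insert (by simpa using h1)⟩
      · rfl
      · rfl
  rw [koszulD, Module.Basis.constr_apply_fintype]
  simp only [Pi.basisFun_equivFun, LinearEquiv.refl_apply, Finset.sum_apply, Pi.smul_apply]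
  have h1 : ∀ F : Finset (Fin n), x F • ∑ i ∈ F, (Pi.single (F.erase i)
      ((-1) ^ (F.filter (· < i)).card * X i) : Ext K n) G =
      ∑ i : Fin n, if i ∈ Gᶜ then (if F = insert i G then koszulSign K i G • (X i * x F) else 0)
        else 0 := by
    intro F
    have h2 : ∑ i ∈ F, (Pi.single (F.erase i)
        ((-1) ^ (F.filter (· < i)).card * X i) : Ext K n) G = ∑ i : Fin n, if i ∈ F then
          (Pi.single (F.erase i) ((-1) ^ (F.filter (· < i)).card * X i) : Ext K n) G else 0 := by
      rw [Finset.sum_ite_mem, Finset.univ_inter]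
    rw [h2, Finset.smul_sum]
    refine Finset.sum_congr rfl fun i _ => ?_
    rw [key]
    split_ifs
    · rw [smul_comm, smul_eq_mul, mul_comm]
    · rw [smul_zero]
    · rw [smul_zero]
  rw [Finset.sum_congr rfl fun F _ => h1 F, Finset.sum_comm, ← Finset.sum_filter_add_sum_filter_not
    Finset.univ (fun i => i ∈ Gᶜ)]
  rw [Finset.sum_eq_zero (s := Finset.univ.filter fun i => ¬ i ∈ Gᶜ), add_zero]
  · rw [Finset.filter_mem_eq_inter, Finset.univ_inter]
    refine Finset.sum_congr rfl fun i hi => ?_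
    simp [hi]
  · intro i hi
    simp only [Finset.mem_filter, Finset.mem_univ, true_and] at hi
    simp only [if_neg hi, Finset.sum_const_zero]

theorem koszulD_koszulD (x : Ext K n) : koszulD K n (koszulD K n x) = 0 := by
  classical
  ext1 G
  rw [koszulD_apply]
  simp only [koszulD_apply, Finset.mul_sum, Finset.smul_sum, Pi.zero_apply, Finset.sum_sigma']
  -- Adding `i` and then `j` cancels against adding `j` and then `i`.
  refine Finset.sum_involution (fun p _ => ⟨p.2, p.1⟩) ?_ ?_ ?_ ?_
  · rintro ⟨i, j⟩ h
    simp only [Finset.mem_sigma, Finset.mem_compl, Finset.mem_insert, not_or] at h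
    obtain ⟨hi, hji, hj⟩ := h
    simp only [mul_smul_comm, smul_smul]
    rw [Finset.insert_comm j i, koszulSign_mul_insert (fun h => hji h.symm) hi hj, neg_smul,
      mul_left_comm, neg_add_cancel]
  · rintro ⟨i, j⟩ h _ heq
    simp only [Finset.mem_sigma, Finset.mem_compl, Finset.mem_insert, not_or] at h
    simp only [Sigma.mk.injEq, heq_eq_eq] at heq
    exact h.2.1 heq.1
  · rintro ⟨i, j⟩ h
    simp only [Finset.mem_sigma, Finset.mem_compl, Finset.mem_insert, not_or] at h ⊢
    exact ⟨h.2.2, fun h' => h.2.1 h'.symm, h.1⟩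
  · rintro ⟨i, j⟩ _
    rfl

theorem mem_extPower {k : ℕ} {x : Ext K n} :
    x ∈ extPower K n k ↔ ∀ F : Finset (Fin n), F.card ≠ k → x F = 0 := by
  classical
  constructor
  · intro hx F hF
    have : extPower K n k ≤ LinearMap.ker (LinearMap.proj (R := MvPolynomial (Fin n) K)
        (φ := fun _ : Finset (Fin n) => MvPolynomial (Fin n) K) F) := by
      refine Submodule.span_le.2 ?_
      rintro _ ⟨G, hG, rfl⟩
      have : F ≠ G := by rintro rfl; exact hF hG
      simp [this]
    exact this hx
  · intro h
    have hx : x = ∑ F, x F • (Pi.single F 1 : Ext K n) := by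
      ext1 G
      simp [Finset.sum_apply, Pi.single_apply]
    rw [hx]
    refine Submodule.sum_mem _ fun F _ => ?_
    by_cases hF : F.card = k
    · exact Submodule.smul_mem _ _ (Submodule.subset_span ⟨F, hF, rfl⟩)
    · rw [h F hF, zero_smul]; exact Submodule.zero_mem _

theorem koszulD_mem_extPower {k : ℕ} {x : Ext K n} (hx : x ∈ extPower K n (k + 1)) :
    koszulD K n x ∈ extPower K n k := by
  classical
  rw [mem_extPower] at hx ⊢
  intro F hF
  rw [koszulD_apply]
  refine Finset.sum_eq_zero fun i hi => ?_
  rw [hx, mul_zero, smul_zero]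
  rw [Finset.card_insert_of_notMem (by simpa using hi)]
  omega

theorem koszulD_extPower_zero {x : Ext K n} (hx : x ∈ extPower K n 0) : koszulD K n x = 0 := by
  classical
  rw [mem_extPower] at hx
  ext1 F
  rw [koszulD_apply]
  refine Finset.sum_eq_zero fun i hi => ?_
  rw [hx _ (by simp), mul_zero, smul_zero]

/-- Division by an indeterminate, forgetting the remainder. -/
def divX (i : Fin n) : MvPolynomial (Fin n) K →ₗ[K] MvPolynomial (Fin n) K where
  toFun f := f.divMonomial (Finsupp.single i 1)
  map_add' f g := add_divMonomial f g _
  map_smul' c f := by ext d; simp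

theorem coeff_divX (i : Fin n) (f : MvPolynomial (Fin n) K) (d : Fin n →₀ ℕ) :
    coeff d (divX i f) = coeff (Finsupp.single i 1 + d) f := rfl

theorem divX_X_mul_self (i : Fin n) (f : MvPolynomial (Fin n) K) : divX i (X i * f) = f :=
  X_mul_divMonomial i f

theorem divX_X_mul {i j : Fin n} (h : i ≠ j) (f : MvPolynomial (Fin n) K) :
    divX i (X j * f) = X j * divX i f := by
  classical
  ext d
  rw [coeff_divX, coeff_X_mul', coeff_X_mul', coeff_divX]
  have h1 : j ∈ (Finsupp.single i 1 + d).support ↔ j ∈ d.support := by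
    simp [h]
  simp only [h1]
  split_ifs with h2
  · congr 1
    ext l
    by_cases hl : l = j
    · subst hl; simp [h]
    · simp [Finsupp.single_apply, Ne.symm hl]
  · rfl

variable (K) in
/-- The contracting homotopy of the Koszul complex in the direction of `X_i`. -/
def koszulHomotopy (i : Fin n) (x : Ext K n) : Ext K n := fun F =>
  if i ∈ F then koszulSign K i (F.erase i) • divX i (x (F.erase i)) else 0

theorem koszulHomotopy_mem_extPower {k : ℕ} (i : Fin n) {x : Ext K n} (hx : x ∈ extPower K n k) :
    koszulHomotopy K i x ∈ extPower K n (k + 1) := by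
  rw [mem_extPower] at hx ⊢
  intro F hF
  rw [koszulHomotopy]
  split_ifs with h
  · rw [hx, map_zero, smul_zero]
    rw [Finset.card_erase_of_mem h]
    have := Finset.card_pos.2 ⟨i, h⟩
    omega
  · rfl

theorem koszulD_koszulHomotopy_of_notMem (i : Fin n) (x : Ext K n) {G : Finset (Fin n)}
    (hG : i ∉ G) : koszulD K n (koszulHomotopy K i x) G = X i * divX i (x G) := by
  classical
  rw [koszulD_apply, Finset.sum_eq_single i]
  · rw [koszulHomotopy, if_pos (Finset.mem_insert_self _ _), Finset.erase_insert hG, mul_smul_comm,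
      smul_smul, koszulSign_mul_self, one_smul]
  · intro j _ hj
    rw [koszulHomotopy, if_neg, mul_zero, smul_zero]
    simp [Ne.symm hj, hG]
  · intro h; exact absurd (by simpa using hG) h

/-- With `h` the homotopy, `∂h + h∂` is the identity on coordinates containing `i`: the terms in
directions `j ≠ i` cancel by the sign rule, and direction `i` returns `x`. On the other coordinates
only the monomials divisible by `X_i` survive, so `h` contracts everything that involves `X_i` or
`e_i`. -/
theorem koszulD_koszulHomotopy_of_mem (i : Fin n) (x : Ext K n) {G : Finset (Fin n)}
    (hG : i ∈ G) : koszulD K n (koszulHomotopy K i x) G + koszulHomotopy K i (koszulD K n x) G =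
      x G := by
  classical
  obtain ⟨H, hH, rfl⟩ : ∃ H, i ∉ H ∧ insert i H = G :=
    ⟨G.erase i, Finset.notMem_erase _ _, Finset.insert_erase hG⟩
  rw [koszulHomotopy, if_pos (Finset.mem_insert_self _ _), Finset.erase_insert hH, koszulD_apply,
    koszulD_apply]
  have hc : Hᶜ = insert i (insert i H)ᶜ := by
    ext j
    simp only [Finset.mem_compl, Finset.mem_insert]
    by_cases h : j = i
    · subst h; simp [hH]
    · simp [h]
  rw [hc, Finset.sum_insert (by simp), map_add, smul_add, map_smul, smul_smul,
    koszulSign_mul_self, one_smul, divX_X_mul_self, add_left_comm, map_sum, Finset.smul_sum,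
    ← Finset.sum_add_distrib, Finset.sum_eq_zero, add_zero]
  intro j hj
  simp only [Finset.mem_compl, Finset.mem_insert, not_or] at hj
  have h1 : (insert j (insert i H)).erase i = insert j H := by
    rw [Finset.insert_comm, Finset.erase_insert]
    simp [hH, Ne.symm hj.1]
  rw [koszulHomotopy, if_pos (by simp), h1, map_smul, divX_X_mul (Ne.symm hj.1), mul_smul_comm,
    smul_smul, smul_smul, koszulSign_insert_mul_insert (Ne.symm hj.1) hH hj.2, neg_smul,
    neg_add_cancel]

/-- Modulo boundaries, a cycle may be replaced by its part that involves neither `X_i` nor `e_i`. -/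
theorem coeff_sub_koszulD_koszulHomotopy (i : Fin n) {x : Ext K n} (hx : koszulD K n x = 0)
    (F : Finset (Fin n)) (d : Fin n →₀ ℕ) :
    coeff d ((x - koszulD K n (koszulHomotopy K i x)) F) =
      if i ∈ F ∨ d i ≠ 0 then 0 else coeff d (x F) := by
  classical
  by_cases hF : i ∈ F
  · have h := koszulD_koszulHomotopy_of_mem i x hF
    have h0 : koszulHomotopy K i (koszulD K n x) F = 0 := by
      rw [hx, koszulHomotopy]; simp
    rw [h0, add_zero] at h
    rw [if_pos (Or.inl hF), Pi.sub_apply, h, sub_self, coeff_zero]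
  · rw [Pi.sub_apply, koszulD_koszulHomotopy_of_notMem i x hF, coeff_sub, coeff_X_mul', coeff_divX]
    by_cases hd : d i = 0
    · simp [hF, hd]
    · have : Finsupp.single i 1 + (d - Finsupp.single i 1) = d :=
        add_tsub_cancel_of_le (by simpa [Finsupp.single_le_iff, Nat.one_le_iff_ne_zero] using hd)
      simp [hd, this]

theorem exists_koszulD_eq {k : ℕ} {x : Ext K n} (hk : x ∈ extPower K n k)
    (hx : koszulD K n x = 0) (h0 : constantCoeff (x ∅) = 0) :
    ∃ y ∈ extPower K n (k + 1), koszulD K n y = x := by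
  classical
  -- Applying the homotopies one direction at a time removes, modulo boundaries, all terms involving
  -- any index of `s`. For `s` the full index set only the constant term at `F = ∅` is left.
  have key : ∀ s : Finset (Fin n), ∃ y ∈ extPower K n (k + 1), ∀ F d,
      coeff d ((x - koszulD K n y) F) =
        if ∃ i ∈ s, i ∈ F ∨ d i ≠ 0 then 0 else coeff d (x F) := by
    intro s
    induction s using Finset.induction_on with
    | empty => exact ⟨0, Submodule.zero_mem _, by simp⟩
    | insert i s _ ih =>
      obtain ⟨y, hy, h⟩ := ih
      have hz : koszulD K n (x - koszulD K n y) = 0 := by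
        rw [map_sub, hx, koszulD_koszulD, sub_zero]
      refine ⟨y + koszulHomotopy K i (x - koszulD K n y), Submodule.add_mem _ hy
        (koszulHomotopy_mem_extPower i (Submodule.sub_mem _ hk (koszulD_mem_extPower hy))),
        fun F d => ?_⟩
      rw [map_add, ← sub_sub, coeff_sub_koszulD_koszulHomotopy i hz, h]
      simp only [Finset.exists_mem_insert]
      by_cases hq : i ∈ F ∨ d i ≠ 0
      · rw [if_pos hq, if_pos (Or.inl hq)]
      · rw [if_neg hq]
        by_cases hp : ∃ i ∈ s, i ∈ F ∨ d i ≠ 0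
        · rw [if_pos hp, if_pos (Or.inr hp)]
        · rw [if_neg hp, if_neg (not_or.2 ⟨hq, hp⟩)]
  obtain ⟨y, hy, h⟩ := key Finset.univ
  refine ⟨y, hy, ?_⟩
  rw [eq_comm, ← sub_eq_zero]
  ext F d
  rw [h, Pi.zero_apply, coeff_zero]
  split_ifs with hc
  · rfl
  · simp only [Finset.mem_univ, true_and, not_exists, not_or, not_not] at hc
    have hF : F = ∅ := Finset.eq_empty_of_forall_notMem fun i => (hc i).1
    have hd : d = 0 := by ext i; exact (hc i).2
    rw [hF, hd]
    exact h0

end Exactness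

/-! ### The Hilbert function of the syzygy modules -/

section Graded

variable {K : Type*} [Field K] {n : ℕ} {ι : Type*} [AddCommGroup ι]

theorem deg_weight {w : Fin n → ι} {deg : ι →+ ℤ} (hdeg : ∀ i, deg (w i) = 1) (d : Fin n →₀ ℕ) :
    deg (Finsupp.weight w d) = d.degree := by
  simp [Finsupp.weight_apply, Finsupp.sum_fintype, hdeg, Finsupp.degree_eq_sum]

/-- By `deg`, all monomials of degree `g` have the same total degree. -/
theorem finiteDimensional_weightedHomogeneousSubmodule {w : Fin n → ι} {deg : ι →+ ℤ}
    (hdeg : ∀ i, deg (w i) = 1) (g : ι) :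
    FiniteDimensional K (weightedHomogeneousSubmodule K w g) := by
  have h : weightedHomogeneousSubmodule K w g ≤
      weightedHomogeneousSubmodule K (fun _ : Fin n => (1 : ℕ)) (deg g).toNat := by
    intro f hf d hd
    have h1 := deg_weight hdeg d
    rw [hf hd] at h1
    rw [h1, Finsupp.weight_apply, Finsupp.sum_fintype _ _ (by simp)]
    rw [Finsupp.degree_eq_sum, Int.toNat_natCast]
    simp
  have : FiniteDimensional K
      (weightedHomogeneousSubmodule K (fun _ : Fin n => (1 : ℕ)) (deg g).toNat) :=
    Module.Finite.iff_fg.2 (weightedHomogeneousSubmodule_fg K _ (fun _ => one_ne_zero) _)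
  exact Submodule.finiteDimensional_of_le h

theorem weightedHomogeneousComponent_X_mul (w : Fin n → ι) (g : ι) (i : Fin n)
    (f : MvPolynomial (Fin n) K) : weightedHomogeneousComponent w g (X i * f) =
      X i * weightedHomogeneousComponent w (g - w i) f := by
  classical
  ext d
  rw [coeff_weightedHomogeneousComponent, coeff_X_mul', coeff_X_mul',
    coeff_weightedHomogeneousComponent]
  by_cases hd : i ∈ d.support
  · have h1 : Finsupp.weight w d = w i + Finsupp.weight w (d - Finsupp.single i 1) := by
      conv_lhs => rw [← add_tsub_cancel_of_le (show Finsupp.single i 1 ≤ d by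
        simpa [Finsupp.single_le_iff, Nat.one_le_iff_ne_zero] using hd)]
      rw [map_add, Finsupp.weight_single, one_smul]
    have h2 : Finsupp.weight w d = g ↔ Finsupp.weight w (d - Finsupp.single i 1) = g - w i := by
      rw [h1, eq_sub_iff_add_eq, add_comm]
    simp only [hd, if_true, h2]
  · simp [hd]

variable (w : Fin n → ι)

/-- The projection of `⋀ Rⁿ` onto its component of degree `g`. -/
def extComponent (g : ι) (x : Ext K n) : Ext K n :=
  fun F => weightedHomogeneousComponent w (g - ∑ i ∈ F, w i) (x F)

variable {w}

theorem mem_extPiece {g : ι} {x : Ext K n} : x ∈ extPiece K w g ↔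
    ∀ F : Finset (Fin n), x F ∈ weightedHomogeneousSubmodule K w (g - ∑ i ∈ F, w i) := by
  simp [extPiece, Submodule.mem_pi]

theorem extComponent_mem (g : ι) (x : Ext K n) : extComponent w g x ∈ extPiece K w g :=
  mem_extPiece.2 fun _ => weightedHomogeneousComponent_mem _ _ _

theorem extComponent_eq_self {g : ι} {x : Ext K n} (hx : x ∈ extPiece K w g) :
    extComponent w g x = x := by
  ext1 F
  exact IsWeightedHomogeneous.weightedHomogeneousComponent_same (mem_extPiece.1 hx F)

theorem extComponent_mem_extPower {k : ℕ} (g : ι) {x : Ext K n} (hx : x ∈ extPower K n k) :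
    extComponent w g x ∈ extPower K n k := by
  rw [mem_extPower] at hx ⊢
  intro F hF
  rw [extComponent, hx F hF, map_zero]

theorem koszulD_extComponent (g : ι) (x : Ext K n) :
    koszulD K n (extComponent w g x) = extComponent w g (koszulD K n x) := by
  classical
  ext1 G
  rw [koszulD_apply, extComponent, koszulD_apply, map_sum]
  refine Finset.sum_congr rfl fun i hi => ?_
  rw [map_smul, weightedHomogeneousComponent_X_mul, extComponent,
    Finset.sum_insert (by simpa using hi), sub_sub, add_comm (w i)]

theorem koszulD_mem_extPiece {g : ι} {x : Ext K n} (hx : x ∈ extPiece K w g) :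
    koszulD K n x ∈ extPiece K w g := by
  rw [← extComponent_eq_self hx, koszulD_extComponent]
  exact extComponent_mem _ _

theorem constantCoeff_of_mem_maxIdeal {f : MvPolynomial (Fin n) K}
    (hf : f ∈ maxIdeal K (Fin n)) : constantCoeff f = 0 := by
  have : maxIdeal K (Fin n) ≤ RingHom.ker (constantCoeff (R := K) (σ := Fin n)) := by
    refine Ideal.span_le.2 ?_
    rintro _ ⟨i, rfl⟩
    simp
  exact this hf

theorem augmentation_eq_zero_iff {x : Ext K n} :
    augmentation K n x = 0 ↔ x ∅ ∈ maxIdeal K (Fin n) := by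
  rw [augmentation, LinearMap.comp_apply, Submodule.mkQ_apply, Submodule.Quotient.mk_eq_zero]
  rfl

theorem augmentation_koszulD (x : Ext K n) : augmentation K n (koszulD K n x) = 0 := by
  classical
  rw [augmentation_eq_zero_iff, koszulD_apply]
  refine Ideal.sum_mem _ fun i _ => ?_
  rw [smul_eq_C_mul]
  exact Ideal.mul_mem_left _ _ (Ideal.mul_mem_right _ _ (Ideal.subset_span ⟨i, rfl⟩))

theorem augmentation_extPower_succ {k : ℕ} {x : Ext K n} (hx : x ∈ extPower K n (k + 1)) :
    augmentation K n x = 0 := by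
  rw [augmentation_eq_zero_iff, mem_extPower.1 hx _ (by simp)]
  exact Ideal.zero_mem _

variable (K w)

/-- The component of degree `g` of `⋀ᵏ Rⁿ`. -/
def extPowerPiece (k : ℕ) (g : ι) : Submodule K (Ext K n) :=
  (extPower K n k).restrictScalars K ⊓ extPiece K w g

variable {K w}

/-- A homogeneous element of the image has a homogeneous preimage, because `∂` commutes with
projection to the component of degree `g`. For `k = 0` the preimage is instead a homogeneous lift
from `R/𝔪`, placed at `F = ∅`. -/
theorem map_syzygyPiece (k : ℕ) (g : ι) :
    (syzygyPiece K w k g).map ((syzygy K n k).subtype.restrictScalars K) =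
      (extPowerPiece K w k g).map ((augmentedD K n).restrictScalars K) := by
  classical
  ext y
  constructor
  · rintro ⟨⟨y, x, hx, rfl⟩, ⟨h1, h2⟩, rfl⟩
    replace h1 : koszulD K n x ∈ extPiece K w g := h1
    replace h2 : augmentation K n x ∈ residuePiece K w g := h2
    cases k with
    | zero =>
      obtain ⟨f, hf, h2⟩ := h2
      refine ⟨Pi.single ∅ f, ⟨mem_extPower.2 fun F hF => ?_, mem_extPiece.2 fun F => ?_⟩, ?_⟩
      · have : F ≠ ∅ := by rintro rfl; exact hF rfl
        simp [this]
      · by_cases hF : F = ∅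
        · subst hF; simpa using hf
        · simp only [Pi.single_eq_of_ne hF]; exact Submodule.zero_mem _
      · change (koszulD K n _, augmentation K n _) = (koszulD K n x, augmentation K n x)
        rw [koszulD_extPower_zero hx, koszulD_extPower_zero, ← h2]
        · simp [augmentation]
        · refine mem_extPower.2 fun F hF => ?_
          have : F ≠ ∅ := by rintro rfl; exact hF rfl
          simp [this]
    | succ k =>
      refine ⟨extComponent w g x, ⟨extComponent_mem_extPower g hx, extComponent_mem g x⟩, ?_⟩
      change (koszulD K n _, augmentation K n _) = (koszulD K n x, augmentation K n x)
      rw [koszulD_extComponent, extComponent_eq_self h1, augmentation_extPower_succ hx,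
        augmentation_extPower_succ (extComponent_mem_extPower g hx)]
  · rintro ⟨x, ⟨hx, hg⟩, rfl⟩
    refine ⟨⟨augmentedD K n x, x, hx, rfl⟩, ⟨koszulD_mem_extPiece hg, ?_⟩, rfl⟩
    refine ⟨x ∅, ?_, rfl⟩
    simpa using mem_extPiece.1 hg ∅

theorem extPowerPiece_inf_ker (k : ℕ) (g : ι) :
    extPowerPiece K w k g ⊓ LinearMap.ker ((augmentedD K n).restrictScalars K) =
      (extPowerPiece K w (k + 1) g).map ((koszulD K n).restrictScalars K) := by
  ext x
  constructor
  · rintro ⟨⟨hx, hg⟩, h⟩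
    have h' : (koszulD K n x, augmentation K n x) = 0 := h
    rw [Prod.mk_eq_zero] at h'
    obtain ⟨y, hy, rfl⟩ := exists_koszulD_eq hx h'.1
      (constantCoeff_of_mem_maxIdeal (augmentation_eq_zero_iff.1 h'.2))
    refine ⟨extComponent w g y, ⟨extComponent_mem_extPower g hy, extComponent_mem g y⟩, ?_⟩
    change koszulD K n _ = _
    rw [koszulD_extComponent, extComponent_eq_self hg]
  · rintro ⟨y, ⟨hy, hg⟩, rfl⟩
    refine ⟨⟨koszulD_mem_extPower hy, koszulD_mem_extPiece hg⟩, ?_⟩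
    change (koszulD K n (koszulD K n y), augmentation K n (koszulD K n y)) = 0
    rw [koszulD_koszulD, augmentation_koszulD, Prod.mk_zero_zero]

theorem map_augmentedD_extPowerPiece_succ (k : ℕ) (g : ι) :
    (extPowerPiece K w (k + 1) g).map ((augmentedD K n).restrictScalars K) =
      ((extPowerPiece K w (k + 1) g).map ((koszulD K n).restrictScalars K)).map
        (LinearMap.inl K (Ext K n) (ResidueField K n)) := by
  rw [← Submodule.map_comp]
  ext y
  refine exists_congr fun x => and_congr_right fun hx => ?_
  have : (augmentedD K n).restrictScalars K x = ((LinearMap.inl K (Ext K n) (ResidueField K n)).comp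
      ((koszulD K n).restrictScalars K)) x := by
    change (koszulD K n x, augmentation K n x) = (koszulD K n x, 0)
    rw [augmentation_extPower_succ hx.1]
  rw [this]

/-- The component of degree `g` of `⋀ᵏ Rⁿ`, in coordinates. -/
def extPowerPieceEquiv (k : ℕ) (g : ι) : extPowerPiece K w k g ≃ₗ[K]
    (∀ F : {F : Finset (Fin n) // F.card = k},
      weightedHomogeneousSubmodule K w (g - ∑ i ∈ F.1, w i)) where
  toFun x F := ⟨x.1 F.1, mem_extPiece.1 x.2.2 F.1⟩
  map_add' _ _ := rfl
  map_smul' _ _ := rfl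
  invFun y := ⟨fun F => if h : F.card = k then y ⟨F, h⟩ else 0,
    mem_extPower.2 fun F hF => dif_neg hF, mem_extPiece.2 fun F => by
      split_ifs with h
      · exact (y ⟨F, h⟩).2
      · exact Submodule.zero_mem _⟩
  left_inv x := by
    ext1
    funext F
    by_cases h : F.card = k
    · simp [h]
    · simp only [h, dif_neg, not_false_eq_true]
      exact (mem_extPower.1 x.2.1 F h).symm
  right_inv y := by
    funext F
    ext1
    simp [F.2]

theorem finiteDimensional_extPowerPiece {deg : ι →+ ℤ} (hdeg : ∀ i, deg (w i) = 1)
    (k : ℕ) (g : ι) :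
    FiniteDimensional K (extPowerPiece K w k g) := by
  have := fun g => finiteDimensional_weightedHomogeneousSubmodule (K := K) hdeg g
  exact Module.Finite.equiv (extPowerPieceEquiv k g).symm

theorem finrank_extPowerPiece {deg : ι →+ ℤ} (hdeg : ∀ i, deg (w i) = 1)
    (k : ℕ) (g : ι) : Module.finrank K (extPowerPiece K w k g) =
    ∑ F : Finset (Fin n) with F.card = k,
      Module.finrank K (weightedHomogeneousSubmodule K w (g - ∑ i ∈ F, w i)) := by
  have := fun g => finiteDimensional_weightedHomogeneousSubmodule (K := K) hdeg g
  rw [(extPowerPieceEquiv k g).finrank_eq, Module.finrank_pi_fintype]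
  exact (Finset.sum_subtype (Finset.univ.filter fun F : Finset (Fin n) => F.card = k)
    (fun F => by simp) (fun F =>
      Module.finrank K (weightedHomogeneousSubmodule K w (g - ∑ i ∈ F, w i)))).symm

theorem finrank_syzygyPiece_eq (k : ℕ) (g : ι) : Module.finrank K (syzygyPiece K w k g) =
    Module.finrank K ((extPowerPiece K w k g).map ((augmentedD K n).restrictScalars K)) := by
  rw [← map_syzygyPiece]
  exact (Submodule.equivMapOfInjective _ (Subtype.val_injective) _).finrank_eq

theorem finiteDimensional_syzygyPiece {deg : ι →+ ℤ} (hdeg : ∀ i, deg (w i) = 1)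
    (k : ℕ) (g : ι) :
    FiniteDimensional K (syzygyPiece K w k g) := by
  have := finiteDimensional_extPowerPiece (K := K) hdeg k g
  have h : FiniteDimensional K
      ((extPowerPiece K w k g).map ((augmentedD K n).restrictScalars K)) := inferInstance
  rw [← map_syzygyPiece] at h
  exact Module.Finite.equiv (Submodule.equivMapOfInjective
    ((syzygy K n k).subtype.restrictScalars K) (Subtype.val_injective) _).symm

theorem finrank_map_add_finrank_inf_ker {V V' : Type*} [AddCommGroup V] [Module K V]
    [AddCommGroup V'] [Module K V'] (f : V →ₗ[K] V') (p : Submodule K V) [FiniteDimensional K p] :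
    Module.finrank K (p.map f) + Module.finrank K (p ⊓ LinearMap.ker f : Submodule K V) =
      Module.finrank K p := by
  rw [← LinearMap.finrank_range_add_finrank_ker (f.domRestrict p), LinearMap.range_domRestrict,
    LinearMap.ker_domRestrict, ← Submodule.map_comap_subtype, Submodule.finrank_map_subtype_eq]

/-- Degree `g` of the exact sequence `0 → M(n,k+1) → ⋀ᵏ Rⁿ → M(n,k) → 0`. -/
theorem finrank_syzygyPiece_add {deg : ι →+ ℤ} (hdeg : ∀ i, deg (w i) = 1)
    (k : ℕ) (g : ι) : Module.finrank K (syzygyPiece K w k g) +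
    Module.finrank K (syzygyPiece K w (k + 1) g) = Module.finrank K (extPowerPiece K w k g) := by
  have := finiteDimensional_extPowerPiece (K := K) hdeg k g
  rw [finrank_syzygyPiece_eq, finrank_syzygyPiece_eq, map_augmentedD_extPowerPiece_succ,
    ← (Submodule.equivMapOfInjective (LinearMap.inl K (Ext K n) (ResidueField K n))
      LinearMap.inl_injective _).finrank_eq, ← extPowerPiece_inf_ker, finrank_map_add_finrank_inf_ker]

theorem finrank_syzygyPiece {deg : ι →+ ℤ} (hdeg : ∀ i, deg (w i) = 1)
    (k : ℕ) (g : ι) : (Module.finrank K (syzygyPiece K w k g) : ℤ) =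
    ∑ F : Finset (Fin n) with k ≤ F.card, (-1) ^ (F.card - k) *
      (Module.finrank K (weightedHomogeneousSubmodule K w (g - ∑ i ∈ F, w i)) : ℤ) := by
  -- Descending induction on `k`: from `k = n + 1` on there are no sets `F` with `|F| ≥ k`, and both
  -- sides vanish.
  obtain ⟨m, hm⟩ : ∃ m, n + 1 ≤ k + m := ⟨n + 1, by omega⟩
  induction m generalizing k with
  | zero =>
    have hF : ∀ F : Finset (Fin n), ¬ k ≤ F.card := fun F => by
      have := F.card_le_univ
      rw [Fintype.card_fin] at this
      omega
    have h1 := finrank_syzygyPiece_add (K := K) hdeg k g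
    rw [finrank_extPowerPiece hdeg, Finset.sum_eq_zero] at h1
    · rw [Finset.sum_eq_zero]
      · have : Module.finrank K (syzygyPiece K w k g) = 0 := by omega
        exact_mod_cast this
      · intro F h
        exact absurd (Finset.mem_filter.1 h).2 (hF F)
    · intro F h
      exact absurd (Finset.mem_filter.1 h).2.ge (hF F)
  | succ m ih =>
    have h1 := finrank_syzygyPiece_add (K := K) hdeg k g
    rw [finrank_extPowerPiece hdeg] at h1
    replace h1 := congrArg (Nat.cast (R := ℤ)) h1
    rw [Nat.cast_add] at h1
    rw [eq_sub_of_add_eq h1, ih (k + 1) (by omega), sub_eq_iff_eq_add]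
    have h2 : (Finset.univ.filter fun F : Finset (Fin n) => k ≤ F.card) =
        (Finset.univ.filter fun F : Finset (Fin n) => F.card = k) ∪
          Finset.univ.filter fun F : Finset (Fin n) => k + 1 ≤ F.card := by
      ext F
      simp only [Finset.mem_filter, Finset.mem_univ, true_and, Finset.mem_union]
      omega
    rw [h2, Finset.sum_union, add_assoc, ← Finset.sum_add_distrib, Finset.sum_eq_zero (s :=
      Finset.univ.filter fun F : Finset (Fin n) => k + 1 ≤ F.card), add_zero]
    · push_cast
      refine Finset.sum_congr rfl fun F h => ?_
      rw [(Finset.mem_filter.1 h).2, Nat.sub_self, pow_zero, one_mul]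
    · intro F h
      have := (Finset.mem_filter.1 h).2
      rw [show F.card - k = F.card - (k + 1) + 1 by omega, pow_succ]
      ring
    · rw [Finset.disjoint_filter]
      intro F _ h
      omega

end Graded

/-! ### The upper bound -/

section UpperBound

variable {K : Type*} [Field K] {n : ℕ} {ι : Type*} [AddCommGroup ι] {w : Fin n → ι}

theorem weight_ne_zero {deg : ι →+ ℤ} (hdeg : ∀ i, deg (w i) = 1) (i : Fin n) : w i ≠ 0 := by
  intro h
  have := hdeg i
  rw [h, map_zero] at this
  exact zero_ne_one this

theorem finrank_weightedHomogeneousSubmodule_zero_ne {deg : ι →+ ℤ} (hdeg : ∀ i, deg (w i) = 1) :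
    Module.finrank K (weightedHomogeneousSubmodule K w 0) ≠ 0 := by
  have := finiteDimensional_weightedHomogeneousSubmodule (K := K) hdeg 0
  have : Nontrivial (weightedHomogeneousSubmodule K w 0) :=
    ⟨⟨⟨1, isWeightedHomogeneous_one K w⟩, 0, fun h => one_ne_zero (congrArg Subtype.val h)⟩⟩
  exact Module.finrank_pos.ne'

theorem weightedHomogeneousSubmodule_eq_bot {deg : ι →+ ℤ} (hdeg : ∀ i, deg (w i) = 1) {g : ι}
    (hg : g ≠ 0) (hd : deg g ≤ 0) : weightedHomogeneousSubmodule K w g = ⊥ := by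
  refine (Submodule.eq_bot_iff _).2 fun f hf => ?_
  ext d
  by_contra hc
  have h1 := hf hc
  have h2 := deg_weight hdeg d
  rw [h1] at h2
  have h3 : d = 0 := by
    rw [← Finsupp.degree_eq_zero_iff]
    omega
  rw [h3, map_zero] at h1
  exact hg h1.symm

/-- The shifted Hilbert functions `H_R(g - s)` are linearly independent. -/
theorem sum_coeff_eq_zero {deg : ι →+ ℤ} (hdeg : ∀ i, deg (w i) = 1) {J : Type*} [Fintype J]
    [DecidableEq ι] (c : J → ℤ) (s : J → ι)
    (h : ∀ g, ∑ j, c j * (Module.finrank K (weightedHomogeneousSubmodule K w (g - s j)) : ℤ) = 0)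
    (t : ι) : ∑ j with s j = t, c j = 0 := by
  classical
  by_contra ht
  -- Triangularity: take `t` of least `deg` among the shifts with nonzero total coefficient and
  -- evaluate at `g = t`. Any other such shift `u` has `deg (t - u) ≤ 0` and `t - u ≠ 0`, so
  -- `R_{t-u} = 0`.
  obtain ⟨t, ht, hmin⟩ := Finset.exists_min_image
    ((Finset.univ.image s).filter fun t => ∑ j with s j = t, c j ≠ 0) deg (by
      refine ⟨t, Finset.mem_filter.2 ⟨?_, ht⟩⟩
      obtain ⟨j, hj, _⟩ := Finset.exists_ne_zero_of_sum_ne_zero ht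
      exact Finset.mem_image.2 ⟨j, Finset.mem_univ _, (Finset.mem_filter.1 hj).2⟩)
  obtain ⟨ht1, ht2⟩ := Finset.mem_filter.1 ht
  have h1 := h t
  rw [← Finset.sum_fiberwise_of_maps_to (s := Finset.univ) (t := Finset.univ.image s) (g := s)
    (fun j _ => Finset.mem_image_of_mem s (Finset.mem_univ j)), Finset.sum_eq_single_of_mem t ht1]
    at h1
  · rw [Finset.sum_congr rfl (g := fun j => c j *
      (Module.finrank K (weightedHomogeneousSubmodule K w 0) : ℤ)) (fun j hj => by
        rw [(Finset.mem_filter.1 hj).2, sub_self]), ← Finset.sum_mul] at h1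
    rcases mul_eq_zero.1 h1 with h2 | h2
    · exact ht2 h2
    · exact finrank_weightedHomogeneousSubmodule_zero_ne (K := K) hdeg (by exact_mod_cast h2)
  · intro u hu hut
    rw [Finset.sum_congr rfl (g := fun j => c j *
      (Module.finrank K (weightedHomogeneousSubmodule K w (t - u)) : ℤ)) (fun j hj => by
        rw [(Finset.mem_filter.1 hj).2]), ← Finset.sum_mul]
    by_cases hc : ∑ j with s j = u, c j = 0
    · rw [hc, zero_mul]
    · have := hmin u (Finset.mem_filter.2 ⟨hu, hc⟩)
      rw [weightedHomogeneousSubmodule_eq_bot hdeg (sub_ne_zero.2 hut.symm) (by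
        rw [map_sub]; omega), finrank_bot]
      simp

theorem finrank_eq_sum_shiftedPiece {M : Type*} [AddCommGroup M] [Module K M]
    {𝓜 : ι → Submodule K M} {deg : ι →+ ℤ} (hdeg : ∀ i, deg (w i) = 1)
    (D : HilbertDecomposition w 𝓜) (g : ι) : Module.finrank K (𝓜 g) =
      (letI := D.fintype; ∑ i, Module.finrank K ((D.retract i).shiftedPiece (D.shift i) g)) := by
  let _ := D.fintype
  have := fun i => finiteDimensional_weightedHomogeneousSubmodule (K := K) hdeg (g - D.shift i)
  have : ∀ i, FiniteDimensional K ((D.retract i).shiftedPiece (D.shift i) g) := fun i =>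
    Submodule.finiteDimensional_of_le inf_le_right
  rw [(D.iso g).some.finrank_eq, Module.finrank_pi_fintype]

theorem length_lt_of_hilbertDecomposition {deg : ι →+ ℤ} (hdeg : ∀ i, deg (w i) = 1) {k : ℕ}
    (hkn : k < n) (D : HilbertDecomposition w (syzygyPiece K w k))
    (rs : List (MvPolynomial (Fin n) K)) (hrs : ∀ r ∈ rs, r ∈ maxIdeal K (Fin n))
    (reg : RingTheory.Sequence.IsWeaklyRegular (∀ i, (D.retract i).Carrier) rs) :
    rs.length < n := by
  classical
  let _ := D.fintype
  by_contra hlen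
  have htop : ∀ i, (D.retract i).S = ⊤ := fun i => by
    refine (D.retract i).eq_top_of_ker_eq_bot ?_
    by_contra hker
    exact hlen ((D.retract i).length_lt_of_isWeaklyRegular (weight_ne_zero hdeg) hker rs hrs
      ((isWeaklyRegular_pi rs).1 reg i))
  -- The two expressions for the Hilbert function, subtracted. With the Koszul terms negated, sets
  -- with `|F| = k + 1` get coefficient `+1`.
  let c : D.I ⊕ Finset (Fin n) → ℤ := Sum.elim (fun _ => 1) fun F =>
    if k ≤ F.card then -(-1) ^ (F.card - k) else 0
  let s : D.I ⊕ Finset (Fin n) → ι := Sum.elim D.shift fun F => ∑ i ∈ F, w i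
  obtain ⟨F₀, -, hF₀⟩ := Finset.exists_subset_card_eq (s := (Finset.univ : Finset (Fin n)))
    (n := k + 1) (by simpa using hkn)
  have key := sum_coeff_eq_zero (K := K) hdeg c s (fun g => by
    have h1 := finrank_eq_sum_shiftedPiece hdeg D g
    have h2 := finrank_syzygyPiece (K := K) hdeg k g
    rw [h1] at h2
    rw [Fintype.sum_sum_type]
    change ∑ i, (1 : ℤ) * (Module.finrank K (weightedHomogeneousSubmodule K w (g - D.shift i)) : ℤ) +
      ∑ F : Finset (Fin n), (if k ≤ F.card then -(-1) ^ (F.card - k) else 0) *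
        (Module.finrank K (weightedHomogeneousSubmodule K w (g - ∑ i ∈ F, w i)) : ℤ) = 0
    simp only [one_mul, ite_mul, zero_mul, neg_mul]
    rw [← Finset.sum_filter, Finset.sum_neg_distrib, ← h2, Nat.cast_sum, add_neg_eq_zero]
    refine Finset.sum_congr rfl fun i _ => ?_
    rw [GradedRetract.shiftedPiece, htop i, Algebra.top_toSubmodule, top_inf_eq])
    (∑ i ∈ F₀, w i)
  have hdF : ∀ F : Finset (Fin n), deg (∑ i ∈ F, w i) = F.card := fun F => by
    simp [map_sum, hdeg]
  -- By `deg`, only sets of size `k + 1` share the degree of `F₀`. So every coefficient collected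
  -- there is nonnegative, and that of `F₀` is 1.
  refine (Finset.sum_pos' (fun j hj => ?_) ⟨Sum.inr F₀, ?_, ?_⟩).ne' key
  · have hj := (Finset.mem_filter.1 hj).2
    rcases j with i | F
    · simp [c]
    · have h1 : F.card = k + 1 := by
        have := congrArg deg hj
        simp only [s, Sum.elim_inr, hdF, hF₀] at this
        exact_mod_cast this
      simp [c, h1]
  · simp [s]
  · simp [c, hF₀]

theorem depth_le_of_hilbertDecomposition {deg : ι →+ ℤ} (hdeg : ∀ i, deg (w i) = 1) {k : ℕ}
    (hkn : k < n) (D : HilbertDecomposition w (syzygyPiece K w k)) :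
    D.depth ≤ ((n - 1 : ℕ) : ℕ∞) := by
  refine sSup_le ?_
  rintro _ ⟨rs, hrs, reg, rfl⟩
  have := length_lt_of_hilbertDecomposition hdeg hkn D rs hrs reg
  exact_mod_cast (by omega : rs.length ≤ n - 1)

end UpperBound

/-! ### Matchings between layers of the Boolean lattice -/

section Matching

/-- Local LYM gives `|𝒜| (j + 1) ≤ |∂𝒜| (n - j)`, and `n - j ≤ j + 1` exactly because `j ≥ ⌊n/2⌋`.
This inequality is where the lower bound on `k` enters. -/
theorem card_le_card_shadow {n j : ℕ} (hj : n / 2 ≤ j) {𝒜 : Finset (Finset (Fin n))}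
    (h𝒜 : ∀ G ∈ 𝒜, G.card = j + 1) : 𝒜.card ≤ 𝒜.shadow.card := by
  rcases 𝒜.eq_empty_or_nonempty with rfl | ⟨G, hG⟩
  · simp
  have h1 : j + 1 ≤ n := by
    have := G.card_le_univ
    rwa [h𝒜 G hG, Fintype.card_fin] at this
  have h2 := Finset.local_lubell_yamamoto_meshalkin_inequality_mul (𝒜 := 𝒜) (r := j + 1)
    (fun G hG => h𝒜 G hG)
  rw [Fintype.card_fin] at h2
  have h3 : 𝒜.shadow.card * (n - (j + 1) + 1) ≤ 𝒜.shadow.card * (j + 1) :=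
    Nat.mul_le_mul_left _ (by omega)
  exact Nat.le_of_mul_le_mul_right (h2.trans h3) (Nat.succ_pos j)

/-- Hall's marriage theorem, where `G` may choose any `G \ {i}` with `i ∈ G`; the union of the
choices of a family contains its shadow. -/
theorem exists_layer_matching {n j : ℕ} (hn : 0 < n) (hj : n / 2 ≤ j) :
    ∃ m : Finset (Fin n) → Fin n, (∀ G : Finset (Fin n), G.card = j + 1 → m G ∈ G) ∧
      ∀ G H : Finset (Fin n), G.card = j + 1 → H.card = j + 1 → G.erase (m G) = H.erase (m H) → G = H := by
  classical
  obtain ⟨f, hf, hmem⟩ := (Finset.all_card_le_biUnion_card_iff_exists_injective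
    fun G : {G : Finset (Fin n) // G.card = j + 1} => G.1.image fun i => G.1.erase i).1 (fun s => by
      have h1 := card_le_card_shadow (𝒜 := s.image Subtype.val) hj (fun G hG => by
        obtain ⟨G, _, rfl⟩ := Finset.mem_image.1 hG
        exact G.2)
      rw [Finset.card_image_of_injective _ Subtype.val_injective] at h1
      refine h1.trans (Finset.card_le_card fun F hF => ?_)
      obtain ⟨_, hG, i, hi, rfl⟩ := Finset.mem_shadow_iff.1 hF
      obtain ⟨G, hGs, rfl⟩ := Finset.mem_image.1 hG
      exact Finset.mem_biUnion.2 ⟨G, hGs, Finset.mem_image_of_mem _ hi⟩)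
  choose m hm using fun G => Finset.mem_image.1 (hmem G)
  -- The value off the layer is arbitrary; `hn` only provides some index.
  refine ⟨fun G => if h : G.card = j + 1 then m ⟨G, h⟩ else ⟨0, hn⟩, fun G hG => ?_,
    fun G H hG hH hGH => ?_⟩
  · beta_reduce
    rw [dif_pos hG]
    exact (hm ⟨G, hG⟩).1
  · beta_reduce at hGH
    rw [dif_pos hG, dif_pos hH] at hGH
    refine congrArg Subtype.val (@hf ⟨G, hG⟩ ⟨H, hH⟩ ?_)
    rw [← (hm ⟨G, hG⟩).2, ← (hm ⟨H, hH⟩).2]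
    exact hGH

theorem exists_matching {n k : ℕ} (hn : 0 < n) (hk : n / 2 ≤ k) :
    ∃ m : Finset (Fin n) → Fin n, (∀ G : Finset (Fin n), k < G.card → m G ∈ G) ∧
      ∀ G H : Finset (Fin n), k < G.card → k < H.card → G.erase (m G) = H.erase (m H) → G = H := by
  have h : ∀ j : ℕ, ∃ m : Finset (Fin n) → Fin n, k ≤ j → (∀ G : Finset (Fin n), G.card = j + 1 → m G ∈ G) ∧
      ∀ G H : Finset (Fin n), G.card = j + 1 → H.card = j + 1 → G.erase (m G) = H.erase (m H) → G = H := fun j => by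
    by_cases hj : k ≤ j
    · obtain ⟨m, h1⟩ := exists_layer_matching hn (hk.trans hj)
      exact ⟨m, fun _ => h1⟩
    · exact ⟨fun _ => ⟨0, hn⟩, fun h => absurd h hj⟩
  choose m hm using h
  have hmem : ∀ G : Finset (Fin n), k < G.card → m (G.card - 1) G ∈ G := fun G hG =>
    (hm (G.card - 1) (by omega)).1 G (by omega)
  refine ⟨fun G => m (G.card - 1) G, hmem, fun G H hG hH he => ?_⟩
  -- Equal erased sets force `G` and `H` into the same layer, so the layer matchings glue.
  have hc : G.card = H.card := by
    have := congrArg Finset.card he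
    rw [Finset.card_erase_of_mem (hmem G hG), Finset.card_erase_of_mem (hmem H hH)] at this
    omega
  refine (hm (G.card - 1) (by omega)).2 G H (by omega) (by omega) ?_
  rw [he, hc]

end Matching

/-! ### Coordinate retracts -/

section CoordinateRetract

variable {K : Type*} [Field K] {n : ℕ} {ι : Type*} [AddCommGroup ι]

variable (K) in
/-- The endomorphism of `R` that sets `X_i = 0` for all `i ∈ T`. -/
def killVars (T : Finset (Fin n)) : MvPolynomial (Fin n) K →ₐ[K] MvPolynomial (Fin n) K :=
  aeval fun i => if i ∈ T then 0 else X i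

theorem killVars_X (T : Finset (Fin n)) (i : Fin n) :
    killVars K T (X i) = if i ∈ T then 0 else X i := by
  rw [killVars, aeval_X]

theorem killVars_killVars (T : Finset (Fin n)) (f : MvPolynomial (Fin n) K) :
    killVars K T (killVars K T f) = killVars K T f := by
  have : (killVars K T).comp (killVars K T) = killVars K T := by
    refine MvPolynomial.algHom_ext fun i => ?_
    rw [AlgHom.comp_apply, killVars_X]
    split_ifs with h
    · rw [map_zero]
    · rw [killVars_X, if_neg h]
  exact DFunLike.congr_fun this f

theorem killVars_monomial (T : Finset (Fin n)) (d : Fin n →₀ ℕ) (c : K) :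
    killVars K T (monomial d c) = if ∃ i ∈ T, d i ≠ 0 then 0 else monomial d c := by
  rw [killVars, aeval_monomial, monomial_eq, Finsupp.prod_fintype _ _ (by simp),
    Finsupp.prod_fintype _ _ (by simp)]
  split_ifs with h
  · obtain ⟨i, hi, hd⟩ := h
    rw [Finset.prod_eq_zero (Finset.mem_univ i), mul_zero]
    rw [if_pos hi, zero_pow hd]
  · push Not at h
    rw [algebraMap_eq]
    congr 1
    refine Finset.prod_congr rfl fun i _ => ?_
    by_cases hi : i ∈ T
    · rw [h i hi, pow_zero, pow_zero]
    · rw [if_neg hi]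

theorem coeff_killVars (T : Finset (Fin n)) (f : MvPolynomial (Fin n) K) (d : Fin n →₀ ℕ) :
    coeff d (killVars K T f) = if ∃ i ∈ T, d i ≠ 0 then 0 else coeff d f := by
  classical
  induction f using MvPolynomial.induction_on' with
  | monomial e c =>
    rw [killVars_monomial]
    by_cases hed : e = d
    · subst hed
      split_ifs <;> simp
    · have h1 : coeff d (monomial e c) = 0 := by rw [coeff_monomial, if_neg hed]
      split_ifs <;> simp [h1]
  | add p q hp hq =>
    rw [map_add, coeff_add, hp, hq, coeff_add]
    split_ifs <;> simp

theorem killVars_mem {w : Fin n → ι} (T : Finset (Fin n)) {g : ι} {f : MvPolynomial (Fin n) K}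
    (hf : f ∈ weightedHomogeneousSubmodule K w g) :
    killVars K T f ∈ weightedHomogeneousSubmodule K w g := by
  intro d hd
  rw [coeff_killVars] at hd
  exact hf (fun h => hd (by rw [h, ite_self]))

variable (K) in
/-- The graded retract `K[X_i : i ∉ T]`. -/
def coordinateRetract (w : Fin n → ι) (T : Finset (Fin n)) : GradedRetract K w where
  S := (killVars K T).range
  π := (killVars K T).rangeRestrict
  π_apply := by
    rintro ⟨_, f, rfl⟩
    ext1
    exact killVars_killVars T f
  π_graded _ _ hf := killVars_mem T hf

theorem coordinateRetract_π (w : Fin n → ι) (T : Finset (Fin n)) (f : MvPolynomial (Fin n) K) :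
    ((coordinateRetract K w T).π f : MvPolynomial (Fin n) K) = killVars K T f := rfl

theorem shiftedPiece_coordinateRetract (w : Fin n → ι) (T : Finset (Fin n)) (s g : ι) :
    (coordinateRetract K w T).shiftedPiece s g =
      (weightedHomogeneousSubmodule K w (g - s)).map (killVars K T).toLinearMap := by
  ext f
  constructor
  · rintro ⟨⟨h, rfl⟩, hf⟩
    exact ⟨killVars K T h, hf, killVars_killVars T h⟩
  · rintro ⟨h, hh, rfl⟩
    exact ⟨⟨h, rfl⟩, killVars_mem T hh⟩

theorem X_mul_mem_iff {w : Fin n → ι} {g : ι} {i : Fin n} {f : MvPolynomial (Fin n) K} :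
    X i * f ∈ weightedHomogeneousSubmodule K w g ↔
      f ∈ weightedHomogeneousSubmodule K w (g - w i) := by
  constructor
  · intro h d hd
    have h1 := h (d := Finsupp.single i 1 + d) (by rwa [coeff_X_mul])
    rw [map_add, Finsupp.weight_single, one_smul] at h1
    rw [← h1, add_sub_cancel_left]
  · intro h
    have := (isWeightedHomogeneous_X K w i).mul h
    rwa [add_sub_cancel] at this

/-- Exactness of `0 → R(-w i) → R → R/(X_i) → 0` in the middle, in degree `g`; the Hilbert function
of `R/(X_i)` follows. -/
theorem inf_ker_killVars_singleton (w : Fin n → ι) (i : Fin n) (g : ι) :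
    weightedHomogeneousSubmodule K w g ⊓ LinearMap.ker (killVars K {i}).toLinearMap =
      (weightedHomogeneousSubmodule K w (g - w i)).map (LinearMap.mulLeft K (X i)) := by
  ext f
  constructor
  · rintro ⟨hf, hk⟩
    replace hk : killVars K {i} f = 0 := hk
    have h1 : f = X i * divX i f := by
      conv_lhs => rw [← divMonomial_add_modMonomial_single f i]
      suffices h : f.modMonomial (Finsupp.single i 1) = 0 by rw [h, add_zero]; rfl
      ext d
      by_cases hd : d i = 0
      · rw [coeff_modMonomial_of_not_le _ (by simp [Finsupp.single_le_iff, hd])]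
        have := coeff_killVars {i} f d
        rw [hk, if_neg (by simpa using hd)] at this
        exact this.symm
      · rw [coeff_modMonomial_of_le _ (by
          simpa [Finsupp.single_le_iff, Nat.one_le_iff_ne_zero] using hd), coeff_zero]
    have h2 : X i * divX i f ∈ weightedHomogeneousSubmodule K w g := by
      rw [← h1]
      exact hf
    exact ⟨divX i f, X_mul_mem_iff.1 h2, h1.symm⟩
  · rintro ⟨f, hf, rfl⟩
    rw [LinearMap.mulLeft_apply]
    have h1 : X i * f ∈ weightedHomogeneousSubmodule K w g := X_mul_mem_iff.2 hf
    refine ⟨h1, ?_⟩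
    rw [SetLike.mem_coe, LinearMap.mem_ker, AlgHom.toLinearMap_apply, map_mul, killVars_X, if_pos (Finset.mem_singleton_self i), zero_mul]

theorem finrank_shiftedPiece_coordinateRetract {w : Fin n → ι} {deg : ι →+ ℤ}
    (hdeg : ∀ i, deg (w i) = 1) {T : Finset (Fin n)} (hT : T.card ≤ 1) (s g : ι) :
    (Module.finrank K ((coordinateRetract K w T).shiftedPiece s g) : ℤ) =
      Module.finrank K (weightedHomogeneousSubmodule K w (g - s)) -
        ∑ i ∈ T, (Module.finrank K (weightedHomogeneousSubmodule K w (g - s - w i)) : ℤ) := by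
  have := finiteDimensional_weightedHomogeneousSubmodule (K := K) hdeg (g - s)
  rw [shiftedPiece_coordinateRetract]
  have h := finrank_map_add_finrank_inf_ker (killVars K T).toLinearMap
    (weightedHomogeneousSubmodule K w (g - s))
  rw [eq_sub_iff_add_eq, ← h]
  push_cast
  congr 1
  rcases Nat.le_one_iff_eq_zero_or_eq_one.1 hT with h0 | h1
  · rw [Finset.card_eq_zero] at h0
    subst h0
    have : LinearMap.ker (killVars K (∅ : Finset (Fin n))).toLinearMap = ⊥ := by
      rw [LinearMap.ker_eq_bot']
      intro f hf
      replace hf : killVars K ∅ f = 0 := hf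
      ext d
      have := coeff_killVars ∅ f d
      rw [hf] at this
      simpa using this.symm
    rw [this, inf_bot_eq, finrank_bot]
    simp
  · obtain ⟨i, rfl⟩ := Finset.card_eq_one.1 h1
    rw [Finset.sum_singleton, inf_ker_killVars_singleton]
    have hinj : Function.Injective (LinearMap.mulLeft K (X i : MvPolynomial (Fin n) K)) :=
      fun a b hab => mul_left_cancel₀ (X_ne_zero i) hab
    rw [(Submodule.equivMapOfInjective _ hinj _).finrank_eq]

/-! ### A regular sequence on all coordinate retracts of codimension at most one -/

variable (K n) in
/-- The indeterminates, indexed by all natural numbers. -/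
def natX (j : ℕ) : MvPolynomial (Fin n) K := if h : j < n then X ⟨j, h⟩ else 0

variable (K n) in
/-- The sequence `X_1 - X_2, X_2 - X_3, …, X_{n-1} - X_n`. -/
def differences : List (MvPolynomial (Fin n) K) :=
  (List.range (n - 1)).map fun j => natX K n j - natX K n (j + 1)

theorem natX_mem_maxIdeal (j : ℕ) : natX K n j ∈ maxIdeal K (Fin n) := by
  rw [natX]
  split_ifs
  · exact Ideal.subset_span ⟨_, rfl⟩
  · exact Ideal.zero_mem _

theorem mem_maxIdeal_of_mem_differences {r : MvPolynomial (Fin n) K}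
    (hr : r ∈ differences K n) : r ∈ maxIdeal K (Fin n) := by
  obtain ⟨j, _, rfl⟩ := List.mem_map.1 hr
  exact Ideal.sub_mem _ (natX_mem_maxIdeal _) (natX_mem_maxIdeal _)

/-- The map on indices that identifies `0, …, i`. -/
def collapse (i : ℕ) (l : Fin n) : Fin n := if l.1 ≤ i then ⟨0, l.pos⟩ else l

variable (K) in
/-- The substitution that identifies `X_0, …, X_i` and kills the images of the `X_t`, `t ∈ T`. -/
def collapseHom (T : Finset (Fin n)) (i : ℕ) :
    MvPolynomial (Fin n) K →ₐ[K] MvPolynomial (Fin n) K :=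
  aeval fun l => killVars K (T.image (collapse i)) (X (collapse i l))

theorem collapseHom_X (T : Finset (Fin n)) (i : ℕ) (l : Fin n) :
    collapseHom K T i (X l) =
      if collapse i l ∈ T.image (collapse i) then 0 else X (collapse i l) := by
  rw [collapseHom, aeval_X, killVars_X]

theorem collapseHom_killVars (T : Finset (Fin n)) (i : ℕ) (f : MvPolynomial (Fin n) K) :
    collapseHom K T i (killVars K T f) = collapseHom K T i f := by
  have : (collapseHom K T i).comp (killVars K T) = collapseHom K T i := by
    refine MvPolynomial.algHom_ext fun l => ?_
    rw [AlgHom.comp_apply, killVars_X]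
    split_ifs with h
    · rw [map_zero, collapseHom_X, if_pos (Finset.mem_image_of_mem _ h)]
    · rfl
  exact DFunLike.congr_fun this f

theorem take_differences (i : ℕ) : (differences K n).take i =
    (List.range (min i (n - 1))).map fun j => natX K n j - natX K n (j + 1) := by
  rw [differences, ← List.map_take, List.take_range]

theorem collapseHom_eq_zero_of_mem (T : Finset (Fin n)) {i : ℕ} {r : MvPolynomial (Fin n) K}
    (hr : r ∈ Ideal.ofList ((differences K n).take i)) : collapseHom K T i r = 0 := by
  have : Ideal.ofList ((differences K n).take i) ≤ RingHom.ker (collapseHom K T i) := by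
    refine Ideal.span_le.2 fun r hr => ?_
    replace hr : r ∈ (differences K n).take i := hr
    rw [take_differences] at hr
    obtain ⟨j, hj, rfl⟩ := List.mem_map.1 hr
    rw [List.mem_range, lt_min_iff] at hj
    have h1 : j < n := by omega
    have h2 : j + 1 < n := by omega
    rw [SetLike.mem_coe, RingHom.mem_ker, map_sub, natX, natX, dif_pos h1, dif_pos h2,
      collapseHom_X, collapseHom_X]
    have h3 : collapse i (⟨j, h1⟩ : Fin n) = collapse i ⟨j + 1, h2⟩ := by
      simp only [collapse]
      rw [if_pos (by omega), if_pos (by omega)]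
    rw [h3, sub_self]
  exact this hr

/-- Modulo `J` each `X_l` equals its collapsed image, and the killed variables are zero. So the
substitution induces the identity modulo `J`, and its kernel lies in `J`. -/
theorem mem_sup_of_collapseHom_eq_zero (T : Finset (Fin n)) {i : ℕ}
    {f : MvPolynomial (Fin n) K} (hf : collapseHom K T i f = 0) :
    f ∈ Ideal.ofList ((differences K n).take i) ⊔ RingHom.ker (killVars K T) := by
  set J := Ideal.ofList ((differences K n).take i) ⊔ RingHom.ker (killVars K T) with hJ
  have hX0 : ∀ j (hj : j < n), j ≤ i → (Ideal.Quotient.mkₐ K J) (X ⟨j, hj⟩) =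
      (Ideal.Quotient.mkₐ K J) (X ⟨0, by omega⟩) := by
    intro j
    induction j with
    | zero => intro _ _; rfl
    | succ j ih =>
      intro hj hji
      rw [← ih (by omega) (by omega), eq_comm, ← sub_eq_zero, ← map_sub,
        Ideal.Quotient.mkₐ_eq_mk, Ideal.Quotient.eq_zero_iff_mem]
      refine Ideal.mem_sup_left (Ideal.subset_span ?_)
      change _ ∈ (differences K n).take i
      rw [take_differences]
      refine List.mem_map.2 ⟨j, List.mem_range.2 (lt_min (by omega) (by omega)), ?_⟩
      rw [natX, natX, dif_pos (by omega), dif_pos hj]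
  have hc : ∀ l : Fin n, (Ideal.Quotient.mkₐ K J) (X l) =
      (Ideal.Quotient.mkₐ K J) (X (collapse i l)) := by
    intro l
    rw [collapse]
    split_ifs with h
    · exact hX0 l l.2 h
    · rfl
  have : (Ideal.Quotient.mkₐ K J).comp (collapseHom K T i) = Ideal.Quotient.mkₐ K J := by
    refine MvPolynomial.algHom_ext fun l => ?_
    rw [AlgHom.comp_apply, collapseHom_X]
    split_ifs with h
    · obtain ⟨t, ht, htl⟩ := Finset.mem_image.1 h
      rw [hc l, ← htl, ← hc t, map_zero, eq_comm, Ideal.Quotient.mkₐ_eq_mk,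
        Ideal.Quotient.eq_zero_iff_mem]
      refine Ideal.mem_sup_right ?_
      rw [RingHom.mem_ker, killVars_X, if_pos ht]
    · exact (hc l).symm
  have h1 := DFunLike.congr_fun this f
  rw [AlgHom.comp_apply, hf, map_zero, eq_comm, Ideal.Quotient.mkₐ_eq_mk,
    Ideal.Quotient.eq_zero_iff_mem] at h1
  exact h1

/-- Hence the quotient of `S` by the first `i` differences embeds into a polynomial ring, where
regularity of the next element amounts to its image being nonzero. -/
theorem mem_smul_top_iff (w : Fin n → ι) (T : Finset (Fin n)) (i : ℕ)
    (x : (coordinateRetract K w T).Carrier) :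
    x ∈ (Ideal.ofList ((differences K n).take i) • ⊤ :
      Submodule (MvPolynomial (Fin n) K) (coordinateRetract K w T).Carrier) ↔
      collapseHom K T i ((coordinateRetract K w T).val x) = 0 := by
  constructor
  · intro hx
    refine Submodule.smul_induction_on hx (fun r hr m _ => ?_) fun x y hx hy => ?_
    · rw [GradedRetract.val_smul, map_mul, coordinateRetract_π, collapseHom_killVars,
        collapseHom_eq_zero_of_mem T hr, zero_mul]
    · rw [map_add, map_add, hx, hy, add_zero]
  · intro hx
    obtain ⟨a, ha, b, hb, hab⟩ := Submodule.mem_sup.1 (mem_sup_of_collapseHom_eq_zero T hx)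
    have h1 : x = a • (coordinateRetract K w T).toCarrier 1 := by
      rw [← (coordinateRetract K w T).toCarrier_val x, ← hab, map_add, ← map_smul, smul_eq_mul,
        mul_one]
      have : (coordinateRetract K w T).toCarrier b = 0 := by
        apply (coordinateRetract K w T).val_injective
        rw [GradedRetract.val_toCarrier, coordinateRetract_π, map_zero]
        exact hb
      rw [this, add_zero]
    rw [h1]
    exact Submodule.smul_mem_smul ha trivial

theorem isWeaklyRegular_coordinateRetract (w : Fin n → ι) {T : Finset (Fin n)} (hT : T.card ≤ 1) :
    RingTheory.Sequence.IsWeaklyRegular (coordinateRetract K w T).Carrier (differences K n) := by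
  rw [isWeaklyRegular_iff_mem]
  intro i hi x hx
  rw [mem_smul_top_iff] at hx ⊢
  rw [GradedRetract.val_smul, map_mul, coordinateRetract_π, collapseHom_killVars] at hx
  refine (mul_eq_zero.1 hx).resolve_left ?_
  have hi' : i < n - 1 := by simpa [differences] using hi
  have h1 : i < n := by omega
  have h2 : i + 1 < n := by omega
  have h0 : 0 < n := by omega
  have hr : (differences K n)[i] = X ⟨i, h1⟩ - X ⟨i + 1, h2⟩ := by
    simp [differences, natX, h1, h2]
  have hc1 : collapse i (⟨i, h1⟩ : Fin n) = ⟨0, h0⟩ := if_pos le_rfl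
  have hc2 : collapse i (⟨i + 1, h2⟩ : Fin n) = ⟨i + 1, h2⟩ := if_neg (by simp)
  have hne : (⟨0, h0⟩ : Fin n) ≠ ⟨i + 1, h2⟩ := by simp [Fin.ext_iff]
  rw [hr, map_sub, collapseHom_X, collapseHom_X, hc1, hc2]
  -- The image of `X_i - X_{i+1}` is `X_0 - X_{i+1}` with killed variables set to zero. It could
  -- vanish only if both were killed, which `|T| ≤ 1` excludes.
  split_ifs with ha hb hb
  · exact absurd (Finset.card_le_one.1 (Finset.card_image_le.trans hT) _ ha _ hb) hne
  · rw [zero_sub]; exact neg_ne_zero.2 (X_ne_zero _)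
  · rw [sub_zero]; exact X_ne_zero _
  · exact sub_ne_zero.2 fun h => hne (X_injective h)

end CoordinateRetract

/-! ### The decomposition of the syzygy modules -/

section Decomposition

variable {K : Type*} [Field K] {n : ℕ} {ι : Type*} [AddCommGroup ι]

/-- The indeterminates by which `F` is extended to a set matched with `F`. -/
def matchedVars (m : Finset (Fin n) → Fin n) (F : Finset (Fin n)) : Finset (Fin n) :=
  Finset.univ.filter fun i => i ∉ F ∧ m (insert i F) = i

theorem mem_matchedVars {m : Finset (Fin n) → Fin n} {F : Finset (Fin n)} {i : Fin n} :
    i ∈ matchedVars m F ↔ i ∉ F ∧ m (insert i F) = i := by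
  simp [matchedVars]

/-- Two such indices would give two sets with the same partner `F`, against injectivity of the
matching. -/
theorem card_matchedVars_le {k : ℕ} {m : Finset (Fin n) → Fin n}
    (hm : ∀ G H : Finset (Fin n), k < G.card → k < H.card →
      G.erase (m G) = H.erase (m H) → G = H) {F : Finset (Fin n)} (hF : k ≤ F.card) :
    (matchedVars m F).card ≤ 1 := by
  refine Finset.card_le_one.2 fun i hi j hj => ?_
  obtain ⟨hi, hmi⟩ := mem_matchedVars.1 hi
  obtain ⟨hj, hmj⟩ := mem_matchedVars.1 hj
  have h := hm (insert i F) (insert j F)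
    (by rw [Finset.card_insert_of_notMem hi]; omega)
    (by rw [Finset.card_insert_of_notMem hj]; omega)
    (by rw [hmi, hmj, Finset.erase_insert hi, Finset.erase_insert hj])
  rw [← hmi, ← hmj, h]

theorem sum_matchedVars {k : ℕ} {m : Finset (Fin n) → Fin n}
    (hmem : ∀ G : Finset (Fin n), k < G.card → m G ∈ G) (v : Finset (Fin n) → ℤ) :
    ∑ F : Finset (Fin n) with k ≤ F.card ∧ Even (F.card - k), ∑ i ∈ matchedVars m F,
      v (insert i F) = ∑ G : Finset (Fin n) with k ≤ G.card ∧ ¬ Even (G.card - k), v G := by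
  rw [Finset.sum_sigma']
  have hpos : ∀ G : Finset (Fin n), k ≤ G.card → ¬ Even (G.card - k) → k < G.card := by
    intro G h1 h2
    refine lt_of_le_of_ne h1 fun h => h2 ?_
    rw [← h, Nat.sub_self]
    exact Even.zero
  -- The pairs `(F, i)` correspond to the sets `G = F ∪ {i}`, with inverse `G ↦ (G \ {m(G)}, m(G))`;
  -- removing one element turns odd `|G| - k` into even.
  refine Finset.sum_bij' (fun p _ => insert p.2 p.1) (fun G _ => ⟨G.erase (m G), m G⟩) ?_ ?_ ?_ ?_ ?_
  · rintro ⟨F, i⟩ h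
    simp only [Finset.mem_sigma, Finset.mem_filter, Finset.mem_univ, true_and,
      mem_matchedVars] at h ⊢
    obtain ⟨⟨h1, h2⟩, h3, -⟩ := h
    rw [Finset.card_insert_of_notMem h3, Nat.sub_add_comm h1, Nat.even_add_one, not_not]
    exact ⟨by omega, h2⟩
  · intro G h
    simp only [Finset.mem_sigma, Finset.mem_filter, Finset.mem_univ, true_and,
      mem_matchedVars] at h ⊢
    have h1 := hpos G h.1 h.2
    have h2 := hmem G h1
    rw [Finset.card_erase_of_mem h2, Finset.insert_erase h2]
    refine ⟨⟨by omega, ?_⟩, Finset.notMem_erase _ _, rfl⟩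
    have h3 := h.2
    rw [show G.card - k = G.card - 1 - k + 1 by omega, Nat.even_add_one, not_not] at h3
    exact h3
  · rintro ⟨F, i⟩ h
    simp only [Finset.mem_sigma, mem_matchedVars] at h
    simp only [h.2.2, Finset.erase_insert h.2.1]
  · intro G h
    simp only [Finset.mem_filter, Finset.mem_univ, true_and] at h
    exact Finset.insert_erase (hmem G (hpos G h.1 h.2))
  · rintro ⟨F, i⟩ _
    rfl

/-- The alternating Koszul sum, regrouped along the matching: each even `F` absorbs the at most one
odd set matched to it. -/
theorem finrank_syzygyPiece_eq_sum_shiftedPiece {w : Fin n → ι} {deg : ι →+ ℤ}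
    (hdeg : ∀ i, deg (w i) = 1) {k : ℕ} {m : Finset (Fin n) → Fin n}
    (hmem : ∀ G : Finset (Fin n), k < G.card → m G ∈ G)
    (hm : ∀ G H : Finset (Fin n), k < G.card → k < H.card →
      G.erase (m G) = H.erase (m H) → G = H) (g : ι) :
    Module.finrank K (syzygyPiece K w k g) =
      ∑ F : {F : Finset (Fin n) // k ≤ F.card ∧ Even (F.card - k)},
        Module.finrank K ((coordinateRetract K w (matchedVars m F.1)).shiftedPiece
          (∑ i ∈ F.1, w i) g) := by
  have h1 := finrank_syzygyPiece (K := K) hdeg k g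
  let v : Finset (Fin n) → ℤ := fun F =>
    (Module.finrank K (weightedHomogeneousSubmodule K w (g - ∑ i ∈ F, w i)) : ℤ)
  have h2 : ∀ F : Finset (Fin n), k ≤ F.card → (Module.finrank K ((coordinateRetract K w
      (matchedVars m F)).shiftedPiece (∑ i ∈ F, w i) g) : ℤ) =
      v F - ∑ i ∈ matchedVars m F, v (insert i F) := by
    intro F hF
    rw [finrank_shiftedPiece_coordinateRetract hdeg (card_matchedVars_le hm hF)]
    congr 1
    refine Finset.sum_congr rfl fun i hi => ?_
    simp only [v]
    rw [Finset.sum_insert (mem_matchedVars.1 hi).1, sub_sub, add_comm (w i)]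
  have h3 : ∑ F : {F : Finset (Fin n) // k ≤ F.card ∧ Even (F.card - k)},
      (Module.finrank K ((coordinateRetract K w (matchedVars m F.1)).shiftedPiece
        (∑ i ∈ F.1, w i) g) : ℤ) =
      ∑ F : Finset (Fin n) with k ≤ F.card ∧ Even (F.card - k),
        (v F - ∑ i ∈ matchedVars m F, v (insert i F)) := by
    rw [Finset.sum_subtype (p := fun F : Finset (Fin n) => k ≤ F.card ∧ Even (F.card - k)) _
      (fun F => by simp)]
    exact Finset.sum_congr rfl fun F _ => h2 F.1 F.2.1
  have h4 : (Module.finrank K (syzygyPiece K w k g) : ℤ) =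
      ∑ F : Finset (Fin n) with k ≤ F.card ∧ Even (F.card - k), v F -
        ∑ F : Finset (Fin n) with k ≤ F.card ∧ ¬ Even (F.card - k), v F := by
    rw [h1, ← Finset.sum_filter_add_sum_filter_not _ (fun F => Even (F.card - k)),
      Finset.filter_filter, Finset.filter_filter, sub_eq_add_neg, ← Finset.sum_neg_distrib]
    congr 1
    · refine Finset.sum_congr rfl fun F hF => ?_
      rw [(Finset.mem_filter.1 hF).2.2.neg_one_pow, one_mul]
    · refine Finset.sum_congr rfl fun F hF => ?_
      rw [(Nat.not_even_iff_odd.1 (Finset.mem_filter.1 hF).2.2).neg_one_pow, neg_one_mul]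
  rw [Finset.sum_sub_distrib, sum_matchedVars hmem, ← h4] at h3
  exact_mod_cast h3.symm

theorem nonempty_linearEquiv_of_finrank_eq {M V : Type*} [AddCommGroup M] [Module K M]
    [AddCommGroup V] [Module K V] (p : Submodule K M) [FiniteDimensional K p]
    [FiniteDimensional K V] (h : Module.finrank K p = Module.finrank K V) :
    Nonempty (p ≃ₗ[K] V) :=
  FiniteDimensional.nonempty_linearEquiv_of_finrank_eq h

theorem exists_hilbertDecomposition {w : Fin n → ι} {deg : ι →+ ℤ} (hdeg : ∀ i, deg (w i) = 1)
    {k : ℕ} (hkn : k < n) (hk : n / 2 ≤ k) :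
    ∃ D : HilbertDecomposition w (syzygyPiece K w k),
      RingTheory.Sequence.IsWeaklyRegular (∀ i, (D.retract i).Carrier) (differences K n) := by
  obtain ⟨m, hmem, hm⟩ := exists_matching (by omega : 0 < n) hk
  let D : HilbertDecomposition w (syzygyPiece K w k) :=
    { I := {F : Finset (Fin n) // k ≤ F.card ∧ Even (F.card - k)}
      retract := fun F => coordinateRetract K w (matchedVars m F.1)
      shift := fun F => ∑ i ∈ F.1, w i
      -- An isomorphism of graded vector spaces is only required degree by degree, so equality of
      -- finite dimensions suffices.
      iso := fun g => by
        have := finiteDimensional_syzygyPiece (K := K) hdeg k g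
        have := fun s => finiteDimensional_weightedHomogeneousSubmodule (K := K) hdeg (g - s)
        have : ∀ F : {F : Finset (Fin n) // k ≤ F.card ∧ Even (F.card - k)}, FiniteDimensional K
            ((coordinateRetract K w (matchedVars m F.1)).shiftedPiece (∑ i ∈ F.1, w i) g) :=
          fun F => Submodule.finiteDimensional_of_le inf_le_right
        have h : Module.finrank K (syzygyPiece K w k g) = Module.finrank K
            (∀ F : {F : Finset (Fin n) // k ≤ F.card ∧ Even (F.card - k)},
              (coordinateRetract K w (matchedVars m F.1)).shiftedPiece (∑ i ∈ F.1, w i) g) := by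
          rw [Module.finrank_pi_fintype]
          exact finrank_syzygyPiece_eq_sum_shiftedPiece hdeg hmem hm g
        exact nonempty_linearEquiv_of_finrank_eq _ h }
  let _ := D.fintype
  exact ⟨D, (isWeaklyRegular_pi _).2 fun F =>
    isWeaklyRegular_coordinateRetract w (card_matchedVars_le hm F.2.1)⟩

theorem isHilbertDepth_syzygyPiece {w : Fin n → ι} {deg : ι →+ ℤ} (hdeg : ∀ i, deg (w i) = 1)
    {k : ℕ} (hkn : k < n) (hk : n / 2 ≤ k) :
    IsHilbertDepth w (syzygyPiece K w k) ((n - 1 : ℕ) : ℕ∞) := by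
  constructor
  · obtain ⟨D, hD⟩ := exists_hilbertDecomposition (K := K) hdeg hkn hk
    refine ⟨D, le_antisymm (depth_le_of_hilbertDecomposition hdeg hkn D) ?_⟩
    exact le_sSup ⟨differences K n, fun r => mem_maxIdeal_of_mem_differences, hD,
      by simp [differences]⟩
  · rintro _ ⟨D, rfl⟩
    exact depth_le_of_hilbertDecomposition hdeg hkn D

end Decomposition

end HilbertDepth

end

/-! ### The two gradings. -/

theorem theorem3p6 (K : Type*) [Field K] (n k : ℕ) (hkn : k < n) (hk : n / 2 ≤ k) :
    HilbertDepth.IsHilbertDepth (HilbertDepth.standardWeight n)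
      (HilbertDepth.syzygyPiece K (HilbertDepth.standardWeight n) k) ((n - 1 : ℕ) : ℕ∞) ∧
    HilbertDepth.IsHilbertDepth (HilbertDepth.multiWeight n)
      (HilbertDepth.syzygyPiece K (HilbertDepth.multiWeight n) k) ((n - 1 : ℕ) : ℕ∞) := by
  -- The total degree is the identity of `ℤ` for the standard grading and the sum of the coordinates
  -- for the multigrading.
  refine ⟨HilbertDepth.isHilbertDepth_syzygyPiece (deg := AddMonoidHom.id ℤ) (fun _ => rfl) hkn hk,
    HilbertDepth.isHilbertDepth_syzygyPiece
      (deg := ∑ i : Fin n, Pi.evalAddMonoidHom (fun _ : Fin n => ℤ) i) (fun i => ?_) hkn hk⟩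
  simp [HilbertDepth.multiWeight, AddMonoidHom.finsetSum_apply]
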